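/- Let $p,q\ge 0$ be integers with $n=p+q\le 5$, and let $\mathcal{C}\ell(p,q)$ be the complex Clifford algebra with identity $e$ and generators $e^1,\dots,e^n$ satisfying $e^ae^b+e^be^a=2\eta^{ab}e$, where $\eta$ is the diagonal matrix with $p$ entries $+1$ followed by $q$ entries $-1$. It has the basis $e^{a_1}\cdots e^{a_k}$, $1\le a_1<\dots<a_k\le n$, $0\le k\le n$ (the empty product is $e$). For $U\in\mathcal{C}\ell(p,q)$ let $U_k$ be its part of rank $k$, i.e. its component in the span of the basis elements with $k$ factors, and put $$U^{\sim}=\sum_{k=0}^n(-1)^{\frac{k(k-1)}2}U_k,\qquad U^{\curlywedge}=\sum_{k=0}^n(-1)^kU_k,\qquad U^{\sim\curlywedge}=(U^{\sim})^{\curlywedge},$$ while $U^{\bigtriangledown}$ is obtained from $U$ by changing the sign of $U_4$ and $U_5$ (for $n=4$ only $U_4$ is present), and $U^{\bigtriangleup}$ by changing the sign of $U_5$. Let $\operatorname{Det}U\in\mathbb{C}$ be the determinant of the matrix $\rho(U)$, where $\rho$ is a faithful (unital) representation of $\mathcal{C}\ell(p,q)$ by complex $N\times N$ matrices with $N$ as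 small as possible among faithful representations. Then, for every $U\in\mathcal{C}\ell(p,q)$, the number $\operatorname{Det}U$ does not depend on the choice of such a $\rho$, and, identifying a complex number $u$ with the element $ue$ of rank $0$, $$\operatorname{Det}U=\begin{cases} U, & n=0;\\ UU^{\curlywedge}, & n=1;\\ UU^{\sim\curlywedge}, & n=2;\\ UU^{\sim}U^{\curlywedge}U^{\sim\curlywedge}=UU^{\sim\curlywedge}U^{\curlywedge}U^{\sim}, & n=3;\\ UU^{\sim}(U^{\curlywedge}U^{\sim\curlywedge})^{\bigtriangledown}=UU^{\sim\curlywedge}(U^{\curlywedge}U^{\sim})^{\bigtriangledown}, & n=4;\\ UU^{\sim}(U^{\curlywedge}U^{\sim\curlywedge})^{\bigtriangledown}\bigl(UU^{\sim}(U^{\curlywedge}U^{\sim\curlywedge})^{\bigtriangledown}\bigr)^{\bigtriangleup}, & n=5. \end{cases}$$ In particular each of these products is an element of rank $0$. -/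

import Mathlib

noncomputable section

namespace ComplexClifford

open Module

/-- The diagonal of the matrix `η`: `p` entries equal to `+1`, followed by `q` entries `-1`. -/
def eta (p q : ℕ) (a : Fin (p + q)) : ℂ := if (a : ℕ) < p then 1 else -1

/-- The quadratic form `v ↦ ∑ a, η a * v a ^ 2` on `ℂ ^ (p + q)`. -/
abbrev form (p q : ℕ) : QuadraticForm ℂ (Fin (p + q) → ℂ) :=
  QuadraticMap.weightedSumSquares ℂ (eta p q)

/-- The complex Clifford algebra `Cl(p,q)`. -/
abbrev Cl (p q : ℕ) : Type := CliffordAlgebra (form p q)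

/-- The generator `e^a`. -/
def gen (p q : ℕ) (a : Fin (p + q)) : Cl p q :=
  CliffordAlgebra.ι (form p q) (Pi.single a 1)

/-- The element `e^A = e^{a₁} ⋯ e^{a_k}`, where `A = {a₁ < ⋯ < a_k}`; `e^∅ = 1`. -/
def blade (p q : ℕ) (A : Finset (Fin (p + q))) : Cl p q :=
  ((A.sort (· ≤ ·)).map (gen p q)).prod

theorem form_single (p q : ℕ) (a : Fin (p + q)) : form p q (Pi.single a 1) = eta p q a := by
  simp [QuadraticMap.weightedSumSquares_apply, Pi.single_apply]

theorem form_isOrtho (p q : ℕ) {a b : Fin (p + q)} (h : a ≠ b) :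
    (form p q).IsOrtho (Pi.single a 1) (Pi.single b 1) := by
  rw [QuadraticMap.isOrtho_def]
  simp only [QuadraticMap.weightedSumSquares_apply, ← Finset.sum_add_distrib]
  refine Finset.sum_congr rfl fun i _ => ?_
  by_cases hia : i = a
  · subst hia; simp [h]
  · simp [Pi.single_apply, hia]

/-- The defining relations `e^a e^b + e^b e^a = 2 η^{ab} e`. -/
theorem gen_mul_gen_add (p q : ℕ) (a b : Fin (p + q)) :
    gen p q a * gen p q b + gen p q b * gen p q a =
      algebraMap ℂ (Cl p q) (2 * if a = b then eta p q a else 0) := by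
  by_cases h : a = b
  · subst h
    rw [← two_mul, gen, CliffordAlgebra.ι_sq_scalar, form_single, if_pos rfl, map_mul,
      map_ofNat]
  · simp [gen, h, CliffordAlgebra.ι_mul_ι_add_swap_of_isOrtho (form_isOrtho p q h)]

theorem contractLeft_prod_eq_zero {M : Type} [AddCommGroup M] [Module ℂ M]
    (Q : QuadraticForm ℂ M) (d : Module.Dual ℂ M) (l : List M) (h : ∀ m ∈ l, d m = 0) :
    CliffordAlgebra.contractLeft d (l.map (CliffordAlgebra.ι Q)).prod = 0 := by
  induction l with
  | nil => simp
  | cons m l ih =>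
    rw [List.map_cons, List.prod_cons, CliffordAlgebra.contractLeft_ι_mul,
      ih fun x hx => h x (List.mem_cons_of_mem _ hx), h m List.mem_cons_self]
    simp

theorem changeForm_prod {M : Type} [AddCommGroup M] [Module ℂ M]
    {Q Q' : QuadraticForm ℂ M} {B : LinearMap.BilinForm ℂ M} (h : B.toQuadraticMap = Q' - Q)
    (l : List M) (hl : l.Pairwise fun x y => B x y = 0) :
    CliffordAlgebra.changeForm h (l.map (CliffordAlgebra.ι Q)).prod =
      (l.map (CliffordAlgebra.ι Q')).prod := by
  induction l with
  | nil => simp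
  | cons m l ih =>
    rw [List.pairwise_cons] at hl
    rw [List.map_cons, List.prod_cons, CliffordAlgebra.changeForm_ι_mul, ih hl.2,
      contractLeft_prod_eq_zero Q' (B m) l hl.1, sub_zero, List.map_cons, List.prod_cons]

theorem equivExterior_blade (p q : ℕ) (A : Finset (Fin (p + q))) :
    CliffordAlgebra.equivExterior (form p q) (blade p q A) =
      (Pi.basisFun ℂ (Fin (p + q))).ExteriorAlgebra A := by
  rw [ExteriorAlgebra.basis_apply_ofCard (Pi.basisFun ℂ (Fin (p + q))) (s := A) rfl,
    ExteriorAlgebra.ιMulti_family, ExteriorAlgebra.ιMulti_apply]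
  have hl : blade p q A = (((A.sort (· ≤ ·)).map fun a => (Pi.single a 1 : Fin (p + q) → ℂ)).map
      (CliffordAlgebra.ι (form p q))).prod := by
    rw [blade, List.map_map]; rfl
  have ho : ((A.sort (· ≤ ·)).map fun a => (Pi.single a 1 : Fin (p + q) → ℂ)).Pairwise
      fun x y => (QuadraticMap.associated (R := ℂ) (-(form p q))) x y = 0 := by
    rw [List.pairwise_map]
    refine List.Pairwise.imp ?_ (A.sort_nodup (· ≤ ·))
    intro a b hab
    have h := QuadraticMap.associated_isOrtho.2 (form_isOrtho p q hab)
    rw [map_neg, LinearMap.neg_apply, LinearMap.neg_apply, h, neg_zero]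
  rw [hl]
  refine (changeForm_prod CliffordAlgebra.changeForm.associated_neg_proof _ ho).trans ?_
  rw [List.map_map]
  congr 1
  refine List.ext_getElem (by simp) fun k h₁ h₂ => ?_
  simp [Set.powersetCard.ofFinEmbEquiv_symm_apply, Finset.orderEmbOfFin_apply]

/-- The basis `e^A` of `Cl(p,q)`, indexed by the subsets `A` of the set of indices. -/
def bladeBasis (p q : ℕ) : Basis (Finset (Fin (p + q))) ℂ (Cl p q) :=
  (Pi.basisFun ℂ (Fin (p + q))).ExteriorAlgebra.map
    (CliffordAlgebra.equivExterior (form p q)).symm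

theorem bladeBasis_apply (p q : ℕ) (A : Finset (Fin (p + q))) :
    bladeBasis p q A = blade p q A := by
  rw [bladeBasis, Basis.map_apply, ← equivExterior_blade, LinearEquiv.symm_apply_apply]

/-- The projection of `U` onto the subspace of elements of rank `k`, spanned by the `e^A` with
`|A| = k`. -/
def gradeProj (p q k : ℕ) : Cl p q →ₗ[ℂ] Cl p q :=
  ∑ A : Finset (Fin (p + q)) with A.card = k,
    ((bladeBasis p q).coord A).smulRight (blade p q A)

theorem gradeProj_blade (p q k : ℕ) (A : Finset (Fin (p + q))) :
    gradeProj p q k (blade p q A) = if A.card = k then blade p q A else 0 := by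
  simp only [gradeProj, LinearMap.sum_apply, LinearMap.smulRight_apply, Basis.coord_apply]
  simp only [← bladeBasis_apply, Basis.repr_self, Finsupp.single_apply, ite_smul, one_smul,
    zero_smul, Finset.sum_ite_eq, Finset.mem_filter, Finset.mem_univ, true_and]

/-- The operation `▽`: it changes the sign of the parts of rank 4 and 5. -/
def nabla {p q : ℕ} : Cl p q →ₗ[ℂ] Cl p q :=
  ∑ k ∈ Finset.range (p + q + 1),
    (if k = 4 ∨ k = 5 then (-1 : ℂ) else 1) • gradeProj p q k

/-- The operation `△`: it changes the sign of the part of rank 5. -/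
def delta {p q : ℕ} : Cl p q →ₗ[ℂ] Cl p q :=
  ∑ k ∈ Finset.range (p + q + 1), (if k = 5 then (-1 : ℂ) else 1) • gradeProj p q k

/-- The reverse `U^~`. -/
def rev {p q : ℕ} (U : Cl p q) : Cl p q := CliffordAlgebra.reverse U

/-- The grade involution `U^⋏`. -/
def gradeInv {p q : ℕ} (U : Cl p q) : Cl p q := CliffordAlgebra.involute U

theorem prod_mul_of_anticommute {R : Type} [Ring R] (x : R) (l : List R)
    (h : ∀ y ∈ l, x * y = -(y * x)) : l.prod * x = (-1) ^ l.length * (x * l.prod) := by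
  induction l with
  | nil => simp
  | cons y l ih =>
    have hy := h y List.mem_cons_self
    rw [List.prod_cons, mul_assoc, ih fun z hz => h z (List.mem_cons_of_mem _ hz),
      ← mul_assoc, ← ((Commute.neg_one_left y).pow_left l.length).eq, mul_assoc,
      ← mul_assoc y, ← neg_eq_iff_eq_neg.2 hy, List.length_cons, pow_succ]
    simp [mul_assoc]

theorem reverse_prod_of_anticommute {R : Type} [Ring R] (l : List R)
    (h : l.Pairwise fun x y => x * y = -(y * x)) :
    l.reverse.prod = (-1) ^ (l.length * (l.length - 1) / 2) * l.prod := by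
  induction l with
  | nil => simp
  | cons x l ih =>
    rw [List.pairwise_cons] at h
    rw [List.reverse_cons, List.prod_append, ih h.2, List.prod_singleton, mul_assoc,
      prod_mul_of_anticommute x l h.1, ← mul_assoc, ← pow_add, List.prod_cons,
      List.length_cons, ← Finset.sum_range_id, ← Finset.sum_range_id, Finset.sum_range_succ]

theorem rev_blade (p q : ℕ) (A : Finset (Fin (p + q))) :
    rev (blade p q A) = (-1 : ℂ) ^ (A.card * (A.card - 1) / 2) • blade p q A := by
  have hl : blade p q A = (((A.sort (· ≤ ·)).map fun a => (Pi.single a 1 : Fin (p + q) → ℂ)).map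
      (CliffordAlgebra.ι (form p q))).prod := by
    rw [blade, List.map_map]; rfl
  rw [rev, hl, CliffordAlgebra.reverse_prod_map_ι, reverse_prod_of_anticommute]
  · simp [Algebra.smul_def]
  · rw [List.map_map, List.pairwise_map]
    refine List.Pairwise.imp ?_ (A.sort_nodup (· ≤ ·))
    intro a b hab
    exact CliffordAlgebra.ι_mul_ι_comm_of_isOrtho (form_isOrtho p q hab)

theorem gradeInv_blade (p q : ℕ) (A : Finset (Fin (p + q))) :
    gradeInv (blade p q A) = (-1 : ℂ) ^ A.card • blade p q A := by
  have hl : blade p q A = (((A.sort (· ≤ ·)).map fun a => (Pi.single a 1 : Fin (p + q) → ℂ)).map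
      (CliffordAlgebra.ι (form p q))).prod := by
    rw [blade, List.map_map]; rfl
  rw [gradeInv, hl, CliffordAlgebra.involute_prod_map_ι, List.length_map, Finset.length_sort]

/-- A matrix representation of `Cl(p,q)` of minimal dimension: `Cl(p,q)` is identified with an
algebra of complex `N × N` matrices (the representation is faithful) and `N` is as small as
possible. For odd `p + q` these are the block diagonal ones with two blocks. -/
structure IsMinimalRep {p q N : ℕ} (ρ : Cl p q →ₐ[ℂ] Matrix (Fin N) (Fin N) ℂ) : Prop where
  faithful : Function.Injective ρ
  minimal : ∀ (M : ℕ) (σ : Cl p q →ₐ[ℂ] Matrix (Fin M) (Fin M) ℂ),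
    Function.Injective σ → N ≤ M

theorem exists_isMinimalRep (p q : ℕ) :
    ∃ (N : ℕ) (ρ : Cl p q →ₐ[ℂ] Matrix (Fin N) (Fin N) ℂ), IsMinimalRep ρ := by
  classical
  have h : ∃ (N : ℕ) (ρ : Cl p q →ₐ[ℂ] Matrix (Fin N) (Fin N) ℂ), Function.Injective ρ := by
    let e := Fintype.equivFin (Finset (Fin (p + q)))
    exact ⟨_, Algebra.leftMulMatrix ((bladeBasis p q).reindex e),
      Algebra.leftMulMatrix_injective _⟩
  obtain ⟨ρ, hρ⟩ := Nat.find_spec h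
  exact ⟨Nat.find h, ρ, hρ, fun M σ hσ => Nat.find_min' h ⟨σ, hσ⟩⟩

/-- The determinant of `U`: the determinant of the matrix of `U` in a matrix representation of
minimal dimension. -/
def Det {p q : ℕ} (U : Cl p q) : ℂ :=
  ((exists_isMinimalRep p q).choose_spec.choose U).det

end ComplexClifford

end

/-! Everything rests on one fact: in a minimal faithful representation of degree `N` the trace of `ρ
U` is `N` times the rank-0 part of `U` (`IsMinimalRep.hasScalarTrace`). A nontrivial blade
anticommutes with some generator and so is traceless, except the pseudoscalar when `n` is odd. There
the two central idempotents built from the pseudoscalar each have rank at least `2 ^ ((n - 1) / 2)`,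
and minimality forces these ranks to be equal.

Over `ℂ` the traces of all powers of a matrix determine its determinant. Hence `(ρ U).det` depends
only on `N = 2 ^ ((n + 1) / 2)` and the rank-0 parts of the powers of `U`. This gives independence
of `ρ`, and shows that any operation preserving those rank-0 parts preserves the determinant:
reversion, grade involution, and suitable sign changes `z + V ↦ z - V`
(`HasScalarTrace.det_sub_eq_det_add`).

Each product `F U` in the theorem has `N` factors `U` up to such operations, so `(ρ (F U)).det = (ρ
U).det ^ N`. Once `F U` is a scalar, its determinant is also `(F U) ^ N`. The resulting `N`-th root
of unity is removed by restricting to the line from `1` to `U`: there both sides are polynomials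
taking the value `1` at `1` (`algebraMap_det_eq`).

That `F U` is a scalar comes from symmetry: `U * rev U` and `U * gradeInv (rev U)` are fixed by an
anti-involution, which leaves few ranks. What remains has the form `(z + V) * (z - V) = z * z - V *
V`. -/

noncomputable section

namespace ComplexClifford

open Module

/-! ### Determinants from traces of powers, and from `N`-th powers on lines -/

section LinearAlgebra

open Polynomial

variable {ι : Type*} [Fintype ι] [DecidableEq ι]

theorem charpoly_eq_prod_roots (A : Matrix ι ι ℂ) :
    A.charpoly = (A.charpoly.roots.map fun r => X - C r).prod := by
  have h := (IsAlgClosed.splits A.charpoly).eq_prod_roots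
  rwa [A.charpoly_monic.leadingCoeff, C_1, one_mul] at h

theorem card_roots_charpoly (A : Matrix ι ι ℂ) :
    Multiset.card A.charpoly.roots = Fintype.card ι := by
  rw [← (IsAlgClosed.splits A.charpoly).natDegree_eq_card_roots, A.charpoly_natDegree_eq_dim]

/-- Both sides are multiplicative in `f`, so splitting `f` reduces this to `X - c`, where it is the
characteristic polynomial evaluated at `c` up to sign. -/
theorem det_aeval (A : Matrix ι ι ℂ) (f : ℂ[X]) :
    (aeval A f).det = (A.charpoly.roots.map fun r => f.eval r).prod := by
  have hlin (c : ℂ) : (aeval A (X - C c)).det =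
      (A.charpoly.roots.map fun r => (X - C c).eval r).prod := by
    have h := congrArg (eval c) (charpoly_eq_prod_roots A)
    rw [Matrix.eval_charpoly, eval_multiset_prod, Multiset.map_map] at h
    have h2 : aeval A (X - C c) = -(Matrix.scalar ι c - A) := by
      simp [Algebra.algebraMap_eq_smul_one, Matrix.smul_one_eq_diagonal]
    have h3 : (fun r : ℂ => (X - C c).eval r) = fun r => -1 * (eval c ∘ fun r => X - C r) r := by
      funext r; simp
    rw [h2, Matrix.det_neg, h, h3, Multiset.prod_map_mul, Multiset.map_const',
      Multiset.prod_replicate, card_roots_charpoly]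
  have hprod (s : Multiset ℂ) : (aeval A (s.map fun c => X - C c).prod).det =
      (A.charpoly.roots.map fun r => (s.map fun c => X - C c).prod.eval r).prod := by
    induction s using Multiset.induction with
    | empty => simp
    | cons c s ih =>
      simp only [Multiset.map_cons, Multiset.prod_cons, map_mul, Matrix.det_mul, eval_mul,
        Multiset.prod_map_mul]
      rw [ih, hlin]
  have h := (IsAlgClosed.splits f).eq_prod_roots
  rw [h]
  simp only [map_mul, Matrix.det_mul, eval_mul, Multiset.prod_map_mul]
  rw [hprod]
  simp [Matrix.algebraMap_eq_diagonal, card_roots_charpoly]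

/-- Applying `det_aeval` to `x - f` for every `x` gives the whole characteristic polynomial of
`f(A)`, hence its trace as the sum of the roots. -/
theorem trace_aeval (A : Matrix ι ι ℂ) (f : ℂ[X]) :
    (aeval A f).trace = (A.charpoly.roots.map fun r => f.eval r).sum := by
  have h : (aeval A f).charpoly =
      ((A.charpoly.roots.map fun r => f.eval r).map fun r => X - C r).prod := by
    refine Polynomial.funext fun x => ?_
    rw [Matrix.eval_charpoly, eval_multiset_prod, Multiset.map_map, Multiset.map_map]
    have h2 : Matrix.scalar ι x - aeval A f = aeval A (C x - f) := by
      simp [Algebra.algebraMap_eq_smul_one, Matrix.smul_one_eq_diagonal]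
    rw [h2, det_aeval]
    simp [Function.comp_def]
  rw [Matrix.trace_eq_sum_roots_charpoly, h, roots_multiset_prod_X_sub_C]

/-- Equal power sums give equal sums of every polynomial over the eigenvalues. An interpolation
polynomial that is `1` at `c` and `0` at the other eigenvalues then reads off the multiplicity of
`c`; characteristic zero makes this count faithful. -/
theorem roots_charpoly_eq_of_trace_pow_eq {A B : Matrix ι ι ℂ}
    (h : ∀ k : ℕ, (A ^ k).trace = (B ^ k).trace) : A.charpoly.roots = B.charpoly.roots := by
  classical
  have hf (f : ℂ[X]) : (A.charpoly.roots.map fun r => f.eval r).sum =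
      (B.charpoly.roots.map fun r => f.eval r).sum := by
    rw [← trace_aeval, ← trace_aeval, aeval_eq_sum_range, aeval_eq_sum_range, Matrix.trace_sum,
      Matrix.trace_sum]
    simp only [Matrix.trace_smul, h]
  ext c
  let s := A.charpoly.roots.toFinset ∪ B.charpoly.roots.toFinset
  let f := Lagrange.interpolate s id fun r : ℂ => if r = c then (1 : ℂ) else 0
  have hs (r : ℂ) (hr : r ∈ s) : f.eval r = if r = c then 1 else 0 :=
    Lagrange.eval_interpolate_at_node (v := id) _ Function.injective_id.injOn hr
  have hc (m : Multiset ℂ) (hm : ∀ r ∈ m, r ∈ s) :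
      (m.map fun r => f.eval r).sum = (m.count c : ℂ) := by
    rw [Multiset.map_congr rfl fun r hr => hs r (hm r hr)]
    clear hm
    induction m using Multiset.induction with
    | empty => simp
    | cons r m ih =>
      rw [Multiset.map_cons, Multiset.sum_cons, ih, Multiset.count_cons]
      simp [eq_comm, add_comm]
  have := hf f
  rw [hc _ fun r hr => by simp only [s, Finset.mem_union, Multiset.mem_toFinset]; exact .inl hr,
    hc _ fun r hr => by simp only [s, Finset.mem_union, Multiset.mem_toFinset]; exact .inr hr]
    at this
  exact_mod_cast this

theorem det_eq_of_trace_pow_eq {A B : Matrix ι ι ℂ}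
    (h : ∀ k : ℕ, (A ^ k).trace = (B ^ k).trace) : A.det = B.det := by
  rw [Matrix.det_eq_prod_roots_charpoly, Matrix.det_eq_prod_roots_charpoly,
    roots_charpoly_eq_of_trace_pow_eq h]

/-- Since `ℂ[X]` is integrally closed, `f` and `g` divide each other, so they differ by a constant,
which the value at `0` fixes. -/
theorem polynomial_eq_of_pow_eq {f g : ℂ[X]} {N : ℕ} (hN : N ≠ 0) (h : f ^ N = g ^ N)
    (hf : f.eval 0 = 1) (hg : g.eval 0 = 1) : f = g := by
  obtain ⟨u, hu⟩ := associated_of_dvd_dvd ((IsIntegrallyClosed.pow_dvd_pow_iff hN).1 h.dvd)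
    ((IsIntegrallyClosed.pow_dvd_pow_iff hN).1 h.symm.dvd)
  obtain ⟨c, -, hc⟩ := Polynomial.isUnit_iff.1 u.isUnit
  rw [← hc] at hu
  have := congrArg (eval 0) hu
  rw [eval_mul, hf, hg, eval_C, one_mul] at this
  rw [← hu, this, C_1, mul_one]

/-- The functions `ℂ → M` that are polynomial with coefficients in `M`. -/
def polyFun (M : Type*) [AddCommGroup M] [Module ℂ M] : Submodule ℂ (ℂ → M) :=
  Submodule.span ℂ {f | ∃ (k : ℕ) (a : M), f = fun t => t ^ k • a}

theorem const_mem_polyFun {M : Type*} [AddCommGroup M] [Module ℂ M] (a : M) :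
    (fun _ => a) ∈ polyFun M :=
  Submodule.subset_span ⟨0, a, by simp⟩

theorem smul_mem_polyFun {M : Type*} [AddCommGroup M] [Module ℂ M] (a : M) :
    (fun t : ℂ => t • a) ∈ polyFun M :=
  Submodule.subset_span ⟨1, a, by simp⟩

theorem map_mem_polyFun {M M' : Type*} [AddCommGroup M] [Module ℂ M] [AddCommGroup M']
    [Module ℂ M'] (L : M →ₗ[ℂ] M') {f : ℂ → M} (hf : f ∈ polyFun M) :
    (fun t => L (f t)) ∈ polyFun M' := by
  induction hf using Submodule.span_induction with
  | mem f hf => obtain ⟨k, a, rfl⟩ := hf; exact Submodule.subset_span ⟨k, L a, by simp⟩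
  | zero => simp only [Pi.zero_apply, map_zero]; exact (polyFun M').zero_mem
  | add f g _ _ hf hg => simpa using! (polyFun M').add_mem hf hg
  | smul c f _ hf => simpa using! (polyFun M').smul_mem c hf

theorem mul_mem_polyFun {R : Type*} [Ring R] [Algebra ℂ R] {f g : ℂ → R} (hf : f ∈ polyFun R)
    (hg : g ∈ polyFun R) : (fun t => f t * g t) ∈ polyFun R := by
  change f * g ∈ polyFun R
  have h := Submodule.mul_mem_mul hf hg
  rw [polyFun, Submodule.span_mul_span] at h
  refine Submodule.span_mono ?_ h
  rintro _ ⟨_, ⟨k, a, rfl⟩, _, ⟨l, b, rfl⟩, rfl⟩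
  exact ⟨k + l, a * b, by funext t; simp [smul_smul, pow_add, mul_comm (t ^ k)]⟩

theorem exists_polynomial_of_mem_polyFun {f : ℂ → ℂ} (hf : f ∈ polyFun ℂ) :
    ∃ F : ℂ[X], ∀ t, F.eval t = f t := by
  induction hf using Submodule.span_induction with
  | mem f hf =>
    obtain ⟨k, a, rfl⟩ := hf
    refine ⟨C a * X ^ k, fun t => ?_⟩
    rw [eval_mul, eval_C, eval_pow, eval_X]
    exact mul_comm _ _
  | zero => exact ⟨0, by simp⟩
  | add f g _ _ hf hg =>
    obtain ⟨F, hF⟩ := hf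
    obtain ⟨G, hG⟩ := hg
    exact ⟨F + G, by simp [hF, hG]⟩
  | smul c f _ hf =>
    obtain ⟨F, hF⟩ := hf
    exact ⟨C c * F, by simp [hF]⟩

theorem exists_polynomial_det (A B : Matrix ι ι ℂ) :
    ∃ F : ℂ[X], ∀ t : ℂ, F.eval t = (A + t • B).det := by
  refine ⟨(A.map C + (X : ℂ[X]) • B.map C).det, fun t => ?_⟩
  rw [← coe_evalRingHom, RingHom.map_det]
  congr 1
  ext i j
  simp [mul_comm (B i j)]

/-- A function `f` that is polynomial on lines is the determinant of a representation of degree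
`N` if it takes the value `1` at `1` and has the same `N`-th power as the determinant. -/
theorem det_eq_of_pow_eq {R : Type*} [Ring R] [Algebra ℂ R] (ρ : R →ₐ[ℂ] Matrix ι ι ℂ)
    [Nonempty ι] {f : R → ℂ} (hf : ∀ U V, (fun t : ℂ => f (U + t • V)) ∈ polyFun ℂ) (h1 : f 1 = 1)
    (h : ∀ U, (ρ U).det ^ Fintype.card ι = f U ^ Fintype.card ι) (U : R) : (ρ U).det = f U := by
  -- On the line `1 + t • (U - 1)` both functions equal `1` at `t = 0`; the claim is read off at `t
  -- = 1`.
  obtain ⟨F, hF⟩ := exists_polynomial_of_mem_polyFun (hf 1 (U - 1))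
  obtain ⟨G, hG⟩ := exists_polynomial_det (ρ 1) (ρ (U - 1))
  have hG' (t : ℂ) : G.eval t = (ρ (1 + t • (U - 1))).det := by rw [hG, map_add, map_smul]
  have hFG : G = F := by
    refine polynomial_eq_of_pow_eq (N := Fintype.card ι) Fintype.card_ne_zero ?_ ?_ ?_
    · refine Polynomial.funext fun t => ?_
      rw [eval_pow, eval_pow, hF, hG', h]
    · simp [hG']
    · simp [hF, h1]
  have h2 := hG' 1
  rw [hFG, hF] at h2
  simpa using h2.symm

end LinearAlgebra

/-! ### Multiplication of blades, the rank-0 part and the trace -/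

section Blades

variable {p q : ℕ}

theorem eta_ne_zero (a : Fin (p + q)) : eta p q a ≠ 0 := by
  rw [eta]; split_ifs <;> simp

theorem gen_mul_gen_swap {a b : Fin (p + q)} (h : a ≠ b) :
    gen p q a * gen p q b = -(gen p q b * gen p q a) :=
  CliffordAlgebra.ι_mul_ι_comm_of_isOrtho (form_isOrtho p q h)

theorem gen_mul_self (a : Fin (p + q)) :
    gen p q a * gen p q a = algebraMap ℂ (Cl p q) (eta p q a) := by
  rw [gen, CliffordAlgebra.ι_sq_scalar, form_single]

@[simp]
theorem blade_empty : blade p q ∅ = 1 := by simp [blade]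

/-- Signs are deliberately not tracked: later uses need only that the scalar is nonzero. -/
theorem prod_gen_perm {l l' : List (Fin (p + q))} (h : l.Perm l') (hl : l.Nodup) :
    ∃ c : ℂ, c ≠ 0 ∧ (l.map (gen p q)).prod = c • (l'.map (gen p q)).prod := by
  induction h with
  | nil => exact ⟨1, one_ne_zero, by simp⟩
  | cons a _ ih =>
    obtain ⟨c, hc, h⟩ := ih (List.nodup_cons.1 hl).2
    exact ⟨c, hc, by simp [h]⟩
  | swap a b l =>
    have hab : b ≠ a := fun h => by simp [h] at hl
    refine ⟨-1, by simp, ?_⟩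
    simp only [List.map_cons, List.prod_cons, ← mul_assoc, gen_mul_gen_swap hab]
    simp
  | trans h₁ h₂ ih₁ ih₂ =>
    obtain ⟨c, hc, h⟩ := ih₁ hl
    obtain ⟨d, hd, h'⟩ := ih₂ (h₁.nodup_iff.1 hl)
    exact ⟨c * d, mul_ne_zero hc hd, by rw [h, h', smul_smul]⟩

theorem gen_mul_blade_of_notMem {a : Fin (p + q)} {B : Finset (Fin (p + q))} (h : a ∉ B) :
    ∃ c : ℂ, c ≠ 0 ∧ gen p q a * blade p q B = c • blade p q (insert a B) := by
  have hn : (a :: B.sort (· ≤ ·)).Nodup := by simp [h]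
  have hp : (a :: B.sort (· ≤ ·)).Perm ((insert a B).sort (· ≤ ·)) := by
    rw [List.perm_ext_iff_of_nodup hn (Finset.sort_nodup _ _)]
    simp
  simpa [blade] using prod_gen_perm hp hn

theorem gen_mul_blade (a : Fin (p + q)) (B : Finset (Fin (p + q))) :
    ∃ c : ℂ, c ≠ 0 ∧ gen p q a * blade p q B = c • blade p q (symmDiff {a} B) := by
  by_cases h : a ∈ B
  · obtain ⟨c, hc, h'⟩ := gen_mul_blade_of_notMem (Finset.notMem_erase a B)
    rw [Finset.insert_erase h] at h'
    have hs : symmDiff {a} B = B.erase a := by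
      ext b
      by_cases hb : b = a <;> simp [Finset.mem_symmDiff, hb, h]
    refine ⟨c⁻¹ * eta p q a, mul_ne_zero (inv_ne_zero hc) (eta_ne_zero a), ?_⟩
    rw [(inv_smul_eq_iff₀ hc).2 h' |>.symm, mul_smul_comm, ← mul_assoc, gen_mul_self, hs,
      ← Algebra.smul_def, smul_smul]
  · have hs : symmDiff {a} B = insert a B := by
      ext b
      by_cases hb : b = a <;> simp [Finset.mem_symmDiff, hb, h]
    rw [hs]
    exact gen_mul_blade_of_notMem h

/-- Generators common to both blades cancel in pairs, because each squares to a nonzero scalar. -/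
theorem blade_mul_blade (A B : Finset (Fin (p + q))) :
    ∃ c : ℂ, c ≠ 0 ∧ blade p q A * blade p q B = c • blade p q (symmDiff A B) := by
  induction A using Finset.induction_on with
  | empty => exact ⟨1, one_ne_zero, by
    rw [blade_empty, one_mul, one_smul, ← Finset.bot_eq_empty, bot_symmDiff]⟩
  | insert a A ha ih =>
    obtain ⟨c, hc, h⟩ := ih
    obtain ⟨d, hd, h'⟩ := gen_mul_blade_of_notMem ha
    obtain ⟨e, he, h''⟩ := gen_mul_blade a (symmDiff A B)
    have hs : insert a A = symmDiff {a} A := by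
      ext b
      by_cases hb : b = a <;> simp [Finset.mem_symmDiff, hb, ha]
    refine ⟨d⁻¹ * c * e, mul_ne_zero (mul_ne_zero (inv_ne_zero hd) hc) he, ?_⟩
    rw [(inv_smul_eq_iff₀ hd).2 h' |>.symm, smul_mul_assoc, mul_assoc, h, mul_smul_comm, h'',
      smul_smul, smul_smul, hs, symmDiff_assoc]

theorem blade_mul_self (A : Finset (Fin (p + q))) :
    ∃ c : ℂ, c ≠ 0 ∧ blade p q A * blade p q A = algebraMap ℂ (Cl p q) c := by
  obtain ⟨c, hc, h⟩ := blade_mul_blade A A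
  exact ⟨c, hc, by rw [h, symmDiff_self, Finset.bot_eq_empty, blade_empty,
    Algebra.algebraMap_eq_smul_one]⟩

theorem blade_mul_gen_of_notMem {a : Fin (p + q)} {B : Finset (Fin (p + q))} (h : a ∉ B) :
    blade p q B * gen p q a = (-1 : ℂ) ^ B.card • (gen p q a * blade p q B) := by
  have := prod_mul_of_anticommute (gen p q a) ((B.sort (· ≤ ·)).map (gen p q)) fun y hy => by
    obtain ⟨b, hb, rfl⟩ := List.mem_map.1 hy
    exact gen_mul_gen_swap fun hab => h (by simpa [hab] using hb)
  rw [blade, this]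
  simp [Algebra.smul_def]

/-- One sign fewer than when `a ∉ B`, since `e^a` commutes with itself; the exponent `B.card + 1`
has the parity of `B.card - 1` without truncated subtraction. -/
theorem blade_mul_gen_of_mem {a : Fin (p + q)} {B : Finset (Fin (p + q))} (h : a ∈ B) :
    blade p q B * gen p q a = (-1 : ℂ) ^ (B.card + 1) • (gen p q a * blade p q B) := by
  obtain ⟨c, hc, h'⟩ := gen_mul_blade_of_notMem (Finset.notMem_erase a B)
  rw [Finset.insert_erase h] at h'
  rw [(inv_smul_eq_iff₀ hc).2 h' |>.symm, smul_mul_assoc, mul_assoc,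
    blade_mul_gen_of_notMem (Finset.notMem_erase a B), ← Finset.card_erase_add_one h, pow_succ,
    pow_succ]
  simp [smul_comm c⁻¹]

/-- The pseudoscalar, the product of all the generators. -/
def pseudoscalar (p q : ℕ) : Cl p q := blade p q Finset.univ

theorem pseudoscalar_mul_gen (a : Fin (p + q)) :
    pseudoscalar p q * gen p q a =
      (-1 : ℂ) ^ (p + q + 1) • (gen p q a * pseudoscalar p q) := by
  simpa [pseudoscalar] using blade_mul_gen_of_mem (Finset.mem_univ a)

theorem pseudoscalar_mul_ι (v : Fin (p + q) → ℂ) :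
    pseudoscalar p q * CliffordAlgebra.ι (form p q) v =
      (-1 : ℂ) ^ (p + q + 1) • (CliffordAlgebra.ι (form p q) v * pseudoscalar p q) := by
  have h : v = ∑ a, v a • (Pi.single a 1 : Fin (p + q) → ℂ) := by
    ext b; simp [Pi.single_apply]
  rw [h, map_sum, Finset.mul_sum, Finset.sum_mul, Finset.smul_sum]
  refine Finset.sum_congr rfl fun a _ => ?_
  rw [map_smul, mul_smul_comm, smul_mul_assoc, smul_comm]
  exact congrArg _ (pseudoscalar_mul_gen a)

theorem commute_pseudoscalar (h : Odd (p + q)) (U : Cl p q) : Commute (pseudoscalar p q) U := by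
  induction U using CliffordAlgebra.induction with
  | algebraMap r => exact (Algebra.commutes r _).symm
  | ι v => rw [commute_iff_eq, pseudoscalar_mul_ι, h.add_one.neg_one_pow, one_smul]
  | mul _ _ ha hb => exact ha.mul_right hb
  | add _ _ ha hb => exact ha.add_right hb

/-- The component of rank `0`. -/
def scalarPart (p q : ℕ) : Cl p q →ₗ[ℂ] ℂ := (bladeBasis p q).coord ∅

theorem scalarPart_blade (A : Finset (Fin (p + q))) :
    scalarPart p q (blade p q A) = if A = ∅ then 1 else 0 := by
  rw [scalarPart, ← bladeBasis_apply, Basis.coord_apply, Basis.repr_self, Finsupp.single_apply]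

theorem scalarPart_algebraMap (c : ℂ) : scalarPart p q (algebraMap ℂ (Cl p q) c) = c := by
  rw [Algebra.algebraMap_eq_smul_one, map_smul, ← blade_empty, scalarPart_blade]
  simp

/-- Two linear maps on `Cl(p,q)` are equal if they agree on the blades. -/
theorem linearMap_ext {M : Type*} [AddCommGroup M] [Module ℂ M] {f g : Cl p q →ₗ[ℂ] M}
    (h : ∀ A, f (blade p q A) = g (blade p q A)) : f = g :=
  (bladeBasis p q).ext fun A => by rw [bladeBasis_apply, h]

/-- The reverse as a linear map. -/
def revₗ (p q : ℕ) : Cl p q →ₗ[ℂ] Cl p q := CliffordAlgebra.reverse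

/-- The grade involution as a linear map. -/
def gradeInvₗ (p q : ℕ) : Cl p q →ₗ[ℂ] Cl p q := CliffordAlgebra.involute.toLinearMap

theorem revₗ_apply (U : Cl p q) : revₗ p q U = rev U := rfl

theorem gradeInvₗ_apply (U : Cl p q) : gradeInvₗ p q U = gradeInv U := rfl

theorem scalarPart_rev (U : Cl p q) : scalarPart p q (rev U) = scalarPart p q U := by
  have h : scalarPart p q ∘ₗ revₗ p q = scalarPart p q := linearMap_ext fun A => by
    rw [LinearMap.comp_apply, revₗ_apply, rev_blade, map_smul, scalarPart_blade]
    split_ifs with h <;> simp [h]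
  exact LinearMap.congr_fun h U

theorem scalarPart_gradeInv (U : Cl p q) : scalarPart p q (gradeInv U) = scalarPart p q U := by
  have h : scalarPart p q ∘ₗ gradeInvₗ p q = scalarPart p q := linearMap_ext fun A => by
    rw [LinearMap.comp_apply, gradeInvₗ_apply, gradeInv_blade, map_smul, scalarPart_blade]
    split_ifs with h <;> simp [h]
  exact LinearMap.congr_fun h U

theorem rev_mul (U V : Cl p q) : rev (U * V) = rev V * rev U := CliffordAlgebra.reverse.map_mul U V

theorem rev_rev (U : Cl p q) : rev (rev U) = U := CliffordAlgebra.reverse_reverse U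

theorem rev_pow (U : Cl p q) (k : ℕ) : rev (U ^ k) = rev U ^ k := by
  induction k with
  | zero => simp [rev]
  | succ k ih => rw [pow_succ, rev_mul, ih, pow_succ']

theorem gradeInv_mul (U V : Cl p q) : gradeInv (U * V) = gradeInv U * gradeInv V :=
  map_mul CliffordAlgebra.involute U V

theorem gradeInv_pow (U : Cl p q) (k : ℕ) : gradeInv (U ^ k) = gradeInv U ^ k :=
  map_pow CliffordAlgebra.involute U k

theorem gradeInv_gradeInv (U : Cl p q) : gradeInv (gradeInv U) = U :=
  CliffordAlgebra.involute_involute U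

theorem gradeInv_rev (U : Cl p q) : gradeInv (rev U) = rev (gradeInv U) :=
  (CliffordAlgebra.reverse_involute U).symm

section Trace

variable {ι : Type*} [Fintype ι] [DecidableEq ι]

/-- `G` is invertible and conjugates `M` to `-M`. -/
theorem trace_eq_zero_of_anticommute {G M : Matrix ι ι ℂ} {c : ℂ} (hc : c ≠ 0)
    (hG : G * G = c • 1) (h : M * G = -(G * M)) : M.trace = 0 := by
  have h1 : (G * (G * M)).trace = -(G * (G * M)).trace := by
    calc (G * (G * M)).trace = (G * M * G).trace := by rw [Matrix.trace_mul_comm]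
      _ = -(G * (G * M)).trace := by rw [mul_assoc, h, mul_neg, Matrix.trace_neg]
  rw [← mul_assoc, hG, smul_mul_assoc, one_mul, Matrix.trace_smul, smul_eq_mul, self_eq_neg] at h1
  exact (mul_eq_zero.1 h1).resolve_left hc

/-- An even nonempty blade anticommutes with any generator it contains, an odd one with any
generator it omits. Only a full blade of odd length escapes; it is central. -/
theorem trace_blade_eq_zero (ρ : Cl p q →ₐ[ℂ] Matrix ι ι ℂ) {A : Finset (Fin (p + q))}
    (hA : A ≠ ∅) (h : Odd A.card → A ≠ Finset.univ) : (ρ (blade p q A)).trace = 0 := by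
  obtain ⟨a, ha⟩ : ∃ a, blade p q A * gen p q a = -(gen p q a * blade p q A) := by
    rcases Nat.even_or_odd A.card with h' | h'
    · obtain ⟨a, ha⟩ := Finset.nonempty_iff_ne_empty.2 hA
      exact ⟨a, by rw [blade_mul_gen_of_mem ha, h'.add_one.neg_one_pow, neg_one_smul]⟩
    · obtain ⟨a, ha⟩ : ∃ a, a ∉ A := by
        by_contra! hall
        exact h h' (Finset.eq_univ_iff_forall.2 hall)
      exact ⟨a, by rw [blade_mul_gen_of_notMem ha, h'.neg_one_pow, neg_one_smul]⟩
  refine trace_eq_zero_of_anticommute (G := ρ (gen p q a)) (eta_ne_zero a) ?_ ?_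
  · rw [← map_mul, gen_mul_self, AlgHom.commutes, Algebra.algebraMap_eq_smul_one]
  · rw [← map_mul, ha, map_neg, map_mul]

/-- The trace of the representation `ρ` is a multiple of the scalar part. -/
def HasScalarTrace (ρ : Cl p q →ₐ[ℂ] Matrix ι ι ℂ) : Prop :=
  ∀ U, (ρ U).trace = Fintype.card ι * scalarPart p q U

theorem hasScalarTrace_of_pseudoscalar {ρ : Cl p q →ₐ[ℂ] Matrix ι ι ℂ}
    (h : Odd (p + q) → (ρ (pseudoscalar p q)).trace = 0) : HasScalarTrace ρ := by
  have h' : Matrix.traceLinearMap ι ℂ ℂ ∘ₗ ρ.toLinearMap =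
      (Fintype.card ι : ℂ) • scalarPart p q := linearMap_ext fun A => by
    rw [LinearMap.comp_apply, LinearMap.smul_apply, scalarPart_blade]
    change (ρ (blade p q A)).trace = _
    split_ifs with hA
    · subst hA; simp
    · rw [smul_zero]
      by_cases hu : Odd A.card ∧ A = Finset.univ
      · rw [hu.2]
        exact h (by simpa [hu.2] using hu.1)
      · exact trace_blade_eq_zero ρ hA fun ho hA' => hu ⟨ho, hA'⟩
  exact fun U => LinearMap.congr_fun h' U

/-- The form `(U, V) ↦ scalarPart (U * V)` is nondegenerate, as distinct blades are orthogonal and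
none is isotropic. The trace hypothesis expresses it through `ρ`, so an element of the kernel has
all coordinates zero. -/
theorem HasScalarTrace.injective [Nonempty ι] {ρ : Cl p q →ₐ[ℂ] Matrix ι ι ℂ}
    (h : HasScalarTrace ρ) : Function.Injective ρ := by
  rw [injective_iff_map_eq_zero]
  intro U hU
  refine (bladeBasis p q).ext_elem fun A => ?_
  obtain ⟨c, hc, hcA⟩ := blade_mul_self A
  have h1 (V : Cl p q) : scalarPart p q (V * blade p q A) = c * (bladeBasis p q).repr V A := by
    have h' : scalarPart p q ∘ₗ LinearMap.mulRight ℂ (blade p q A) =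
        c • (bladeBasis p q).coord A := linearMap_ext fun B => by
      rw [LinearMap.comp_apply, LinearMap.mulRight_apply, LinearMap.smul_apply,
        Basis.coord_apply, ← bladeBasis_apply p q B, Basis.repr_self, Finsupp.single_apply,
        bladeBasis_apply]
      by_cases hBA : B = A
      · subst hBA
        rw [hcA, scalarPart_algebraMap]
        simp
      · obtain ⟨d, -, hd⟩ := blade_mul_blade B A
        rw [hd, map_smul, scalarPart_blade, if_neg, if_neg hBA, smul_zero, smul_zero]
        rwa [← Finset.bot_eq_empty, symmDiff_eq_bot]
    exact LinearMap.congr_fun h' V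
  have h2 := h (U * blade p q A)
  rw [map_mul, hU, zero_mul, Matrix.trace_zero, h1] at h2
  simpa [hc] using h2

end Trace

end Blades

/-! ### Degree and trace of minimal faithful representations -/

section MinimalRep

variable {p q : ℕ}

/-- Doubling step: the old matrices become `diag(g, -g)`, and two off-diagonal Pauli-type matrices
are added. -/
theorem exists_anticommuting_matrices (m : ℕ) :
    ∃ (ι : Type) (_ : Fintype ι) (_ : DecidableEq ι) (g : ℕ → Matrix ι ι ℂ),
      Fintype.card ι = 2 ^ m ∧ (∀ i < 2 * m, g i * g i = 1) ∧
      ∀ i < 2 * m, ∀ j < 2 * m, i ≠ j → g i * g j = -(g j * g i) := by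
  induction m with
  | zero => exact ⟨Unit, inferInstance, inferInstance, fun _ => 0, by simp, by simp, by simp⟩
  | succ m ih =>
    obtain ⟨ι, _, _, g, hι, hg, hgg⟩ := ih
    let g' : ℕ → Matrix (ι ⊕ ι) (ι ⊕ ι) ℂ := fun i =>
      if i < 2 * m then Matrix.fromBlocks (g i) 0 0 (-(g i))
      else if i = 2 * m then Matrix.fromBlocks 0 1 1 0
      else Matrix.fromBlocks 0 (Complex.I • 1) (-Complex.I • 1) 0
    have h1 {i : ℕ} (hi : i < 2 * m) : g' i = Matrix.fromBlocks (g i) 0 0 (-(g i)) := if_pos hi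
    have h2 : g' (2 * m) = Matrix.fromBlocks 0 1 1 0 := by simp [g']
    have h3 : g' (2 * m + 1) =
        Matrix.fromBlocks 0 (Complex.I • 1) (-Complex.I • 1) 0 := by simp [g']
    have hlt {i : ℕ} (hi : i < 2 * (m + 1)) : i < 2 * m ∨ i = 2 * m ∨ i = 2 * m + 1 := by omega
    refine ⟨ι ⊕ ι, inferInstance, inferInstance, g', by simp [hι, pow_succ, mul_two], ?_, ?_⟩
    · intro i hi
      rcases hlt hi with hi | rfl | rfl
      · simp [h1 hi, Matrix.fromBlocks_multiply, hg i hi]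
      · simp [h2, Matrix.fromBlocks_multiply]
      · simp [h3, Matrix.fromBlocks_multiply, smul_smul]
    · intro i hi j hj hij
      rcases hlt hi with hi | rfl | rfl <;> rcases hlt hj with hj | rfl | rfl
      · simp [h1 hi, h1 hj, Matrix.fromBlocks_multiply, hgg i hi j hj hij, Matrix.fromBlocks_neg]
      · simp [h1 hi, h2, Matrix.fromBlocks_multiply, Matrix.fromBlocks_neg]
      · simp [h1 hi, h3, Matrix.fromBlocks_multiply, Matrix.fromBlocks_neg]
      · simp [h1 hj, h2, Matrix.fromBlocks_multiply, Matrix.fromBlocks_neg]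
      · exact absurd rfl hij
      · simp [h2, h3, Matrix.fromBlocks_multiply, Matrix.fromBlocks_neg]
      · simp [h1 hj, h3, Matrix.fromBlocks_multiply, Matrix.fromBlocks_neg]
      · simp [h2, h3, Matrix.fromBlocks_multiply, Matrix.fromBlocks_neg]
      · exact absurd rfl hij

theorem sq_sum_smul_of_anticommute {R κ : Type*} [Ring R] [Algebra ℂ R] [Fintype κ]
    [DecidableEq κ] (G : κ → R) (d : κ → ℂ) (hsq : ∀ a, G a * G a = algebraMap ℂ R (d a))
    (hG : ∀ a b, a ≠ b → G a * G b = -(G b * G a)) (v : κ → ℂ) :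
    (∑ a, v a • G a) * ∑ a, v a • G a = algebraMap ℂ R (∑ a, d a * (v a * v a)) := by
  -- Twice the square can be written as a symmetrised double sum, in which the off-diagonal terms
  -- vanish.
  have h2 : (2 : ℂ) • ((∑ a, v a • G a) * ∑ a, v a • G a) =
      (2 : ℂ) • algebraMap ℂ R (∑ a, d a * (v a * v a)) := by
    have h1 : (∑ a, v a • G a) * ∑ a, v a • G a =
        ∑ a, ∑ b, (v a * v b) • (G a * G b) := by
      simp only [Finset.sum_mul_sum, smul_mul_smul_comm]
    have h1' : (∑ a, v a • G a) * ∑ a, v a • G a =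
        ∑ a, ∑ b, (v a * v b) • (G b * G a) := by
      rw [h1, Finset.sum_comm]
      simp only [mul_comm]
    rw [two_smul]
    nth_rw 1 [h1]
    rw [h1']
    simp only [← Finset.sum_add_distrib, ← smul_add]
    rw [map_sum, Finset.smul_sum]
    refine Finset.sum_congr rfl fun a _ => ?_
    rw [Finset.sum_eq_single a]
    · rw [hsq, ← two_smul ℂ, smul_comm, mul_comm (d a), map_mul _ (v a * v a),
        Algebra.smul_def (v a * v a)]
    · intro b _ hb
      rw [hG b a hb, add_neg_cancel, smul_zero]
    · simp
  exact smul_right_injective R (two_ne_zero (α := ℂ)) h2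

/-- Anticommuting matrices rescaled by square roots of `η` give the representation. For odd `p + q`
one matrix of the family is left over; it anticommutes with the image of the pseudoscalar and so
kills its trace. -/
theorem exists_hasScalarTrace (p q : ℕ) :
    ∃ ρ : Cl p q →ₐ[ℂ] Matrix (Fin (2 ^ ((p + q + 1) / 2))) (Fin (2 ^ ((p + q + 1) / 2))) ℂ,
      HasScalarTrace ρ := by
  obtain ⟨ι, _, _, g, hι, hg, hgg⟩ := exists_anticommuting_matrices ((p + q + 1) / 2)
  choose s hs using fun a => IsAlgClosed.exists_pow_nat_eq (eta p q a) (n := 2) two_pos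
  let G : Fin (p + q) → Matrix ι ι ℂ := fun a => s a • g a
  have hlt (a : Fin (p + q)) : (a : ℕ) < 2 * ((p + q + 1) / 2) := by omega
  have hsq (a) : G a * G a = algebraMap ℂ _ (eta p q a) := by
    rw [smul_mul_smul_comm, hg _ (hlt a), ← sq, hs, Algebra.algebraMap_eq_smul_one]
  have hG (a b) (hab : a ≠ b) : G a * G b = -(G b * G a) := by
    rw [smul_mul_smul_comm, smul_mul_smul_comm, hgg _ (hlt a) _ (hlt b) (Fin.val_ne_of_ne hab),
      mul_comm, smul_neg]
  let ρ : Cl p q →ₐ[ℂ] Matrix ι ι ℂ :=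
    CliffordAlgebra.lift (form p q) ⟨Fintype.linearCombination ℂ G, fun v => by
      rw [Fintype.linearCombination_apply, sq_sum_smul_of_anticommute G (eta p q) hsq hG,
        QuadraticMap.weightedSumSquares_apply]
      simp only [smul_eq_mul]⟩
  have hρ (a) : ρ (gen p q a) = G a := by
    simp [ρ, gen, Fintype.linearCombination_apply, Pi.single_apply]
  have htr : HasScalarTrace ρ := hasScalarTrace_of_pseudoscalar fun hodd => by
    have hn : p + q < 2 * ((p + q + 1) / 2) := by obtain ⟨k, hk⟩ := hodd; omega
    refine trace_eq_zero_of_anticommute (G := g (p + q)) one_ne_zero ?_ ?_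
    · rw [hg _ hn, one_smul]
    · rw [pseudoscalar, blade, map_list_prod, List.map_map, prod_mul_of_anticommute]
      · simp [hodd.neg_one_pow]
      · intro y hy
        obtain ⟨a, -, rfl⟩ := List.mem_map.1 hy
        rw [Function.comp_apply, hρ, mul_smul_comm, smul_mul_assoc,
          hgg _ hn _ (hlt a) a.isLt.ne', smul_neg]
  let e : ι ≃ Fin (2 ^ ((p + q + 1) / 2)) := Fintype.equivFinOfCardEq hι
  refine ⟨(Matrix.reindexAlgEquiv ℂ ℂ e).toAlgHom.comp ρ, fun U => ?_⟩
  have := htr U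
  rw [hι] at this
  rw [Fintype.card_fin, ← this]
  change Matrix.trace (Matrix.reindex e e (ρ U)) = _
  simp [Matrix.trace, Equiv.sum_comp e.symm fun i => ρ U i i]

theorem finrank_cl (p q : ℕ) : finrank ℂ (Cl p q) = 2 ^ (p + q) := by
  rw [finrank_eq_card_basis (bladeBasis p q), Fintype.card_finset, Fintype.card_fin]

instance finite_cl (p q : ℕ) : Module.Finite ℂ (Cl p q) := Module.Finite.of_basis (bladeBasis p q)

/-- A central element whose grade involution is its complement cuts out at least half of a
faithful representation. -/
theorem two_pow_le_sq_finrank_range {V : Type*} [AddCommGroup V] [Module ℂ V]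
    [FiniteDimensional ℂ V] (ρ : Cl p q →ₐ[ℂ] End ℂ V) (hρ : Function.Injective ρ) {P : Cl p q}
    (hc : ∀ U, Commute P U) (hP' : gradeInv P = 1 - P) :
    2 ^ (p + q) ≤ 2 * finrank ℂ (LinearMap.range (ρ P)) ^ 2 := by
  have hmem (U : Cl p q) : ∀ x ∈ LinearMap.range (ρ P), ρ U x ∈ LinearMap.range (ρ P) := by
    rintro _ ⟨y, rfl⟩
    refine ⟨ρ U y, ?_⟩
    rw [← Module.End.mul_apply, ← Module.End.mul_apply, ← map_mul, ← map_mul, (hc U).eq]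
  let φ : Cl p q →ₗ[ℂ] End ℂ (LinearMap.range (ρ P)) :=
    { toFun := fun U => (ρ U).restrict (hmem U)
      map_add' := fun U V => by ext x; simp
      map_smul' := fun c U => by ext x; simp }
  -- The action on the image of `P` has as kernel the annihilator of `P`.
  have hker : LinearMap.ker φ = LinearMap.ker (LinearMap.mulRight ℂ P) := by
    ext U
    rw [LinearMap.mem_ker, LinearMap.mem_ker, LinearMap.mulRight_apply]
    constructor
    · intro h
      refine hρ ?_
      rw [map_mul, map_zero]
      ext x
      have := congrArg Subtype.val (LinearMap.congr_fun h ⟨ρ P x, x, rfl⟩)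
      exact this
    · intro h
      ext ⟨_, y, rfl⟩
      have : ρ (U * P) y = 0 := by rw [h]; simp
      rw [map_mul] at this
      exact this
  have h1 := LinearMap.finrank_range_add_finrank_ker φ
  have h2 : finrank ℂ (LinearMap.range φ) ≤ finrank ℂ (LinearMap.range (ρ P)) ^ 2 := by
    refine (Submodule.finrank_le _).trans_eq ?_
    rw [finrank_linearMap, sq]
  let K := LinearMap.ker (LinearMap.mulRight ℂ P)
  -- The grade involution carries the annihilator of `P` to that of `1 - P`, and only `0` is killed
  -- by both. So `K` has at most half the dimension of the algebra, and the image of `φ` at least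
  -- half.
  have hK : Disjoint K (K.map (gradeInvₗ p q)) := by
    rw [Submodule.disjoint_def]
    rintro U hU ⟨V, hV, rfl⟩
    have hV' : V * P = 0 := hV
    have h3 : gradeInv V * (1 - P) = 0 := by
      rw [← hP', ← gradeInv_mul, hV', gradeInv, map_zero]
    have h4 : gradeInv V * P = 0 := hU
    rw [mul_sub, h4, sub_zero, mul_one] at h3
    exact h3
  have hinj : Function.Injective (gradeInvₗ p q) := fun U V h => by
    rw [← gradeInv_gradeInv U, ← gradeInv_gradeInv V]
    exact congrArg _ h
  have h3 := Submodule.finrank_add_finrank_le_of_disjoint hK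
  rw [← (Submodule.equivMapOfInjective _ hinj K).finrank_eq] at h3
  rw [hker] at h1
  rw [finrank_cl] at h1 h3
  change _ + finrank ℂ K = _ at h1
  omega

theorem finrank_range_eq_trace {V : Type*} [AddCommGroup V] [Module ℂ V]
    [FiniteDimensional ℂ V] {f : End ℂ V} (hf : IsIdempotentElem f) :
    LinearMap.trace ℂ V f = finrank ℂ (LinearMap.range f) := by
  refine LinearMap.IsProj.trace ⟨fun x => ⟨x, rfl⟩, ?_⟩
  rintro _ ⟨x, rfl⟩
  rw [← Module.End.mul_apply, hf.eq]

variable {N : ℕ} {ρ : Cl p q →ₐ[ℂ] Matrix (Fin N) (Fin N) ℂ}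

theorem IsMinimalRep.le_two_pow (h : IsMinimalRep ρ) : N ≤ 2 ^ ((p + q + 1) / 2) := by
  obtain ⟨σ, hσ⟩ := exists_hasScalarTrace p q
  exact h.minimal _ σ hσ.injective

theorem two_pow_le_sq_of_injective (h : Function.Injective ρ) : 2 ^ (p + q) ≤ N ^ 2 := by
  have := LinearMap.finrank_le_finrank_of_injective (f := ρ.toLinearMap) h
  rwa [finrank_cl, finrank_matrix, finrank_self, Fintype.card_fin, mul_one, ← sq] at this

/-- With `p + q = 2 * k + 1` and `w` the pseudoscalar scaled to `w * w = 1`, the central idempotents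
`(1 ± w) / 2` have ranks at least `2 ^ k` adding up to `N ≤ 2 ^ (k + 1)`. Both ranks are therefore
`2 ^ k`, and their difference is the trace of `ρ w`. -/
theorem IsMinimalRep.eq_and_trace_pseudoscalar (h : IsMinimalRep ρ) (hodd : Odd (p + q)) :
    N = 2 ^ ((p + q + 1) / 2) ∧ (ρ (pseudoscalar p q)).trace = 0 := by
  obtain ⟨k, hk⟩ := hodd
  obtain ⟨c, hc, hω⟩ := blade_mul_self (p := p) (q := q) Finset.univ
  obtain ⟨d, hd⟩ := IsAlgClosed.exists_pow_nat_eq c⁻¹ (n := 2) two_pos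
  have hd0 : d ≠ 0 := by rintro rfl; exact hc (by simpa using hd.symm)
  let w : Cl p q := d • pseudoscalar p q
  have hww : w * w = 1 := by
    change d • blade p q _ * d • blade p q _ = 1
    rw [smul_mul_smul_comm, hω, ← sq, hd, Algebra.smul_def, ← map_mul, inv_mul_cancel₀ hc, map_one]
  have hwc (U : Cl p q) : Commute w U := (commute_pseudoscalar ⟨k, hk⟩ U).smul_left d
  have hwg : gradeInv w = -w := by
    change gradeInvₗ p q (d • blade p q _) = -(d • blade p q _)
    rw [map_smul, gradeInvₗ_apply, gradeInv_blade, Finset.card_univ, Fintype.card_fin,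
      Odd.neg_one_pow ⟨k, hk⟩, neg_one_smul, smul_neg]
  let σ : Cl p q →ₐ[ℂ] End ℂ (Fin N → ℂ) := (Matrix.toLinAlgEquiv' (R := ℂ)).toAlgHom.comp ρ
  have hσ : Function.Injective σ := (Matrix.toLinAlgEquiv' (R := ℂ)).injective.comp h.faithful
  have htr (U : Cl p q) : LinearMap.trace ℂ _ (σ U) = (ρ U).trace :=
    Matrix.trace_toLin'_eq (ρ U)
  let P (s : ℂ) : Cl p q := (2⁻¹ : ℂ) • (1 + s • w)
  have key (s : ℂ) (hs : s * s = 1) : 2 ^ k ≤ finrank ℂ (LinearMap.range (σ (P s))) ∧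
      (2⁻¹ : ℂ) * (N + s * (ρ w).trace) = finrank ℂ (LinearMap.range (σ (P s))) := by
    have hP : IsIdempotentElem (P s) := by
      change (2⁻¹ : ℂ) • (1 + s • w) * (2⁻¹ : ℂ) • (1 + s • w) = (2⁻¹ : ℂ) • (1 + s • w)
      rw [smul_mul_smul_comm, add_mul, mul_add, mul_add, smul_mul_smul_comm, hs, hww]
      simp only [mul_one, one_mul, one_smul]
      module
    constructor
    · have := two_pow_le_sq_finrank_range σ hσ
        (fun U => ((Commute.one_left U).add_left ((hwc U).smul_left s)).smul_left _) (by
          change gradeInvₗ p q ((2⁻¹ : ℂ) • (1 + s • w)) = 1 - (2⁻¹ : ℂ) • (1 + s • w)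
          rw [map_smul, map_add, map_smul, gradeInvₗ_apply, gradeInvₗ_apply, hwg, gradeInv, map_one]
          module)
      have hpow : 2 ^ (p + q) = (2 ^ k) ^ 2 * 2 := by rw [hk, pow_succ, pow_mul']
      rw [hpow] at this
      exact (Nat.pow_le_pow_iff_left two_ne_zero).1
        (Nat.le_of_mul_le_mul_left (by rwa [mul_comm 2]) two_pos)
    · have hPσ : IsIdempotentElem (σ (P s)) := by rw [IsIdempotentElem, ← map_mul, hP.eq]
      rw [← finrank_range_eq_trace hPσ, htr]
      simp [P, mul_add]
  obtain ⟨h1, h1'⟩ := key 1 (by norm_num)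
  obtain ⟨h2, h2'⟩ := key (-1) (by norm_num)
  have hN := h.le_two_pow
  have hk' : (p + q + 1) / 2 = k + 1 := by omega
  rw [hk', pow_succ] at hN ⊢
  have hsum : N = finrank ℂ (LinearMap.range (σ (P 1))) +
      finrank ℂ (LinearMap.range (σ (P (-1)))) := by
    have : (N : ℂ) = finrank ℂ (LinearMap.range (σ (P 1))) +
      finrank ℂ (LinearMap.range (σ (P (-1)))) := by
      rw [← h1', ← h2']; ring
    exact_mod_cast this
  have heq : finrank ℂ (LinearMap.range (σ (P 1))) =
      finrank ℂ (LinearMap.range (σ (P (-1)))) := by omega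
  refine ⟨by omega, ?_⟩
  rw [heq, ← h2'] at h1'
  have hw0 : (ρ w).trace = 0 := by linear_combination h1'
  rw [map_smul, Matrix.trace_smul, smul_eq_mul] at hw0
  exact (mul_eq_zero.1 hw0).resolve_left hd0

/-- In even dimension the lower bound is the dimension count `2 ^ (p + q) ≤ N ^ 2`. -/
theorem IsMinimalRep.eq_two_pow (h : IsMinimalRep ρ) : N = 2 ^ ((p + q + 1) / 2) := by
  rcases Nat.even_or_odd (p + q) with he | ho
  · refine le_antisymm h.le_two_pow ?_
    obtain ⟨k, hk⟩ := he
    have := two_pow_le_sq_of_injective h.faithful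
    rw [hk, ← mul_two, pow_mul] at this
    rw [hk, show (k + k + 1) / 2 = k by omega]
    exact (Nat.pow_le_pow_iff_left two_ne_zero).1 this
  · exact (h.eq_and_trace_pseudoscalar ho).1

theorem IsMinimalRep.hasScalarTrace (h : IsMinimalRep ρ) : HasScalarTrace ρ :=
  hasScalarTrace_of_pseudoscalar fun ho => (h.eq_and_trace_pseudoscalar ho).2

end MinimalRep

/-! ### Parts of given rank under the involutions -/

section Grades

variable {p q : ℕ}

theorem sum_gradeProj (U : Cl p q) : ∑ k ∈ Finset.range (p + q + 1), gradeProj p q k U = U := by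
  have h : ∑ k ∈ Finset.range (p + q + 1), gradeProj p q k = LinearMap.id := by
    refine linearMap_ext fun A => ?_
    have hA : A.card < p + q + 1 := by
      have := A.card_le_univ
      rw [Fintype.card_fin] at this
      omega
    simp [LinearMap.sum_apply, gradeProj_blade, hA]
  simpa [LinearMap.sum_apply] using LinearMap.congr_fun h U

theorem gradeProj_rev (k : ℕ) (U : Cl p q) :
    gradeProj p q k (rev U) = (-1 : ℂ) ^ (k * (k - 1) / 2) • gradeProj p q k U := by
  have h : gradeProj p q k ∘ₗ revₗ p q = (-1 : ℂ) ^ (k * (k - 1) / 2) • gradeProj p q k :=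
    linearMap_ext fun A => by
      rw [LinearMap.comp_apply, revₗ_apply, rev_blade, map_smul, LinearMap.smul_apply,
        gradeProj_blade]
      split_ifs with hA
      · rw [hA]
      · simp
  exact LinearMap.congr_fun h U

theorem gradeProj_gradeInv (k : ℕ) (U : Cl p q) :
    gradeProj p q k (gradeInv U) = (-1 : ℂ) ^ k • gradeProj p q k U := by
  have h : gradeProj p q k ∘ₗ gradeInvₗ p q = (-1 : ℂ) ^ k • gradeProj p q k :=
    linearMap_ext fun A => by
      rw [LinearMap.comp_apply, gradeInvₗ_apply, gradeInv_blade, map_smul, LinearMap.smul_apply,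
        gradeProj_blade]
      split_ifs with hA
      · rw [hA]
      · simp
  exact LinearMap.congr_fun h U

theorem eq_zero_of_eq_neg {U : Cl p q} (h : U = -U) : U = 0 := by
  have h2 : (2 : ℂ) • U = 0 := by
    rw [two_smul]
    exact add_eq_zero_iff_eq_neg.2 h
  exact (smul_eq_zero.1 h2).resolve_left two_ne_zero

/-- This removes the ranks congruent to `2` or `3` modulo `4`. -/
theorem gradeProj_eq_zero_of_rev {U : Cl p q} (hU : rev U = U) {k : ℕ}
    (hk : Odd (k * (k - 1) / 2)) : gradeProj p q k U = 0 := by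
  have h := gradeProj_rev k U
  rw [hU, hk.neg_one_pow, neg_one_smul] at h
  exact eq_zero_of_eq_neg h

/-- This removes the ranks congruent to `1` or `2` modulo `4`. -/
theorem gradeProj_eq_zero_of_gradeInv_rev {U : Cl p q} (hU : gradeInv (rev U) = U) {k : ℕ}
    (hk : Odd (k + k * (k - 1) / 2)) : gradeProj p q k U = 0 := by
  have h := gradeProj_gradeInv k (rev U)
  rw [hU, gradeProj_rev, smul_smul, ← pow_add, hk.neg_one_pow, neg_one_smul] at h
  exact eq_zero_of_eq_neg h

theorem scalarPart_gradeProj {k : ℕ} (hk : k ≠ 0) (U : Cl p q) :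
    scalarPart p q (gradeProj p q k U) = 0 := by
  have h : scalarPart p q ∘ₗ gradeProj p q k = 0 := linearMap_ext fun A => by
    rw [LinearMap.comp_apply, gradeProj_blade]
    split_ifs with hA
    · rw [scalarPart_blade, if_neg, LinearMap.zero_apply]
      rintro rfl
      exact hk hA.symm
    · simp
  exact LinearMap.congr_fun h U

theorem gradeProj_mem {k : ℕ} {S : Submodule ℂ (Cl p q)}
    (h : ∀ A : Finset (Fin (p + q)), A.card = k → blade p q A ∈ S) (U : Cl p q) :
    gradeProj p q k U ∈ S := by
  rw [gradeProj, LinearMap.sum_apply]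
  exact S.sum_mem fun A hA => S.smul_mem _ (h A (Finset.mem_filter.1 hA).2)

theorem exists_gradeProj_zero (U : Cl p q) :
    ∃ s, gradeProj p q 0 U = algebraMap ℂ (Cl p q) s := by
  have h := gradeProj_mem (k := 0) (S := ℂ ∙ (1 : Cl p q)) (fun A hA => by
    rw [Finset.card_eq_zero.1 hA, blade_empty]
    exact Submodule.mem_span_singleton_self _) U
  obtain ⟨s, hs⟩ := Submodule.mem_span_singleton.1 h
  exact ⟨s, by rw [← hs, Algebra.algebraMap_eq_smul_one]⟩

theorem exists_gradeProj_one (U : Cl p q) :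
    ∃ v, gradeProj p q 1 U = CliffordAlgebra.ι (form p q) v := by
  obtain ⟨v, hv⟩ := gradeProj_mem (k := 1)
    (S := LinearMap.range (CliffordAlgebra.ι (form p q))) (fun A hA => by
      obtain ⟨a, rfl⟩ := Finset.card_eq_one.1 hA
      exact ⟨Pi.single a 1, by simp [blade, gen]⟩) U
  exact ⟨v, hv.symm⟩

/-- The blade omitting only `e^a` is a nonzero multiple of `e^a` times the pseudoscalar. -/
theorem exists_gradeProj_of_add_one_eq {k : ℕ} (hk : k + 1 = p + q) (U : Cl p q) :
    ∃ v, gradeProj p q k U = CliffordAlgebra.ι (form p q) v * pseudoscalar p q := by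
  obtain ⟨v, hv⟩ := gradeProj_mem (k := k)
    (S := LinearMap.range (LinearMap.mulRight ℂ (pseudoscalar p q) ∘ₗ
      CliffordAlgebra.ι (form p q))) (fun A hA => by
      have hA' : Aᶜ.card = 1 := by rw [Finset.card_compl, Fintype.card_fin]; omega
      obtain ⟨a, ha⟩ := Finset.card_eq_one.1 hA'
      obtain ⟨c, hc, h⟩ := gen_mul_blade a (Finset.univ : Finset (Fin (p + q)))
      have hs : symmDiff {a} Finset.univ = A := by
        rw [← ha, ← Finset.top_eq_univ, symmDiff_top, hnot_eq_compl, compl_compl]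
      rw [hs] at h
      refine ⟨c⁻¹ • Pi.single a 1, ?_⟩
      rw [map_smul]
      exact (inv_smul_eq_iff₀ hc).2 h) U
  exact ⟨v, hv.symm⟩

theorem exists_gradeProj_last {k : ℕ} (hk : k = p + q) (U : Cl p q) :
    ∃ t : ℂ, gradeProj p q k U = t • pseudoscalar p q := by
  have h := gradeProj_mem (k := k) (S := ℂ ∙ pseudoscalar p q) (fun A hA => by
    rw [Finset.card_eq_iff_eq_univ A |>.1 (by rw [hA, hk, Fintype.card_fin])]
    exact Submodule.mem_span_singleton_self _) U
  obtain ⟨t, ht⟩ := Submodule.mem_span_singleton.1 h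
  exact ⟨t, ht.symm⟩

theorem nabla_apply {m : ℕ} (hm : p + q = m) (U : Cl p q) :
    nabla U = ∑ k ∈ Finset.range (m + 1),
      (if k = 4 ∨ k = 5 then (-1 : ℂ) else 1) • gradeProj p q k U := by
  rw [nabla, LinearMap.sum_apply, show Finset.range (p + q + 1) = Finset.range (m + 1) by rw [hm]]
  rfl

theorem eq_sum_gradeProj {m : ℕ} (hm : p + q = m) (U : Cl p q) :
    U = ∑ k ∈ Finset.range (m + 1), gradeProj p q k U := by
  rw [show Finset.range (m + 1) = Finset.range (p + q + 1) by rw [hm], sum_gradeProj]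

theorem delta_blade (A : Finset (Fin (p + q))) :
    delta (blade p q A) = (if A.card = 5 then (-1 : ℂ) else 1) • blade p q A := by
  have hA : A.card < p + q + 1 := by
    have := A.card_le_univ
    rw [Fintype.card_fin] at this
    omega
  rw [delta, LinearMap.sum_apply, Finset.sum_eq_single A.card]
  · rw [LinearMap.smul_apply, gradeProj_blade, if_pos rfl]
  · intro k _ hk
    rw [LinearMap.smul_apply, gradeProj_blade, if_neg hk.symm, smul_zero]
  · intro h
    exact absurd (Finset.mem_range.2 hA) h

theorem nabla_one : nabla (1 : Cl p q) = 1 := by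
  rw [← blade_empty, nabla, LinearMap.sum_apply, Finset.sum_eq_single 0]
  · rw [LinearMap.smul_apply, gradeProj_blade, if_pos Finset.card_empty]
    simp
  · intro k _ hk
    rw [LinearMap.smul_apply, gradeProj_blade, Finset.card_empty, if_neg hk.symm, smul_zero]
  · simp

theorem delta_one : delta (1 : Cl p q) = 1 := by
  rw [← blade_empty, delta_blade]
  simp

theorem rev_one : rev (1 : Cl p q) = 1 := CliffordAlgebra.reverse.map_one

theorem gradeInv_one : gradeInv (1 : Cl p q) = 1 := map_one CliffordAlgebra.involute

theorem rev_mul_rev_self (U : Cl p q) : rev (U * rev U) = U * rev U := by rw [rev_mul, rev_rev]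

theorem gradeInv_rev_mul_self (U : Cl p q) :
    gradeInv (rev (U * gradeInv (rev U))) = U * gradeInv (rev U) := by
  rw [rev_mul, gradeInv_mul, gradeInv_rev (gradeInv (rev U)), gradeInv_gradeInv, rev_rev]

theorem scalarPart_ι (v : Fin (p + q) → ℂ) :
    scalarPart p q (CliffordAlgebra.ι (form p q) v) = 0 := by
  have h : scalarPart p q ∘ₗ CliffordAlgebra.ι (form p q) = 0 :=
    (Pi.basisFun ℂ (Fin (p + q))).ext fun a => by
      have ha : CliffordAlgebra.ι (form p q) (Pi.single a 1) = blade p q {a} := by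
        simp [blade, gen]
      rw [LinearMap.comp_apply, Pi.basisFun_apply, ha, scalarPart_blade]
      simp
  exact LinearMap.congr_fun h v

/-- The product has rank `p + q - 1`; for `p + q = 1` this would be rank `0`, whence the exclusion.
-/
theorem scalarPart_ι_mul_pseudoscalar (hn : p + q ≠ 1) (v : Fin (p + q) → ℂ) :
    scalarPart p q (CliffordAlgebra.ι (form p q) v * pseudoscalar p q) = 0 := by
  have h : scalarPart p q ∘ₗ LinearMap.mulRight ℂ (pseudoscalar p q) ∘ₗ
      CliffordAlgebra.ι (form p q) = 0 :=
    (Pi.basisFun ℂ (Fin (p + q))).ext fun a => by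
      rw [LinearMap.comp_apply, LinearMap.comp_apply, LinearMap.mulRight_apply, Pi.basisFun_apply]
      obtain ⟨c, -, hc⟩ := gen_mul_blade a (Finset.univ : Finset (Fin (p + q)))
      change scalarPart p q (gen p q a * blade p q Finset.univ) = 0
      rw [hc, map_smul, scalarPart_blade, if_neg, smul_zero]
      rw [← Finset.bot_eq_empty, symmDiff_eq_bot]
      intro h'
      have := congrArg Finset.card h'
      rw [Finset.card_singleton, Finset.card_univ, Fintype.card_fin] at this
      exact hn this.symm
  exact LinearMap.congr_fun h v

end Grades

/-! ### Operations preserving the determinant, and the criterion for a determinant formula -/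

section Determinant

variable {p q : ℕ} {ι : Type*} [Fintype ι] [DecidableEq ι] {ρ : Cl p q →ₐ[ℂ] Matrix ι ι ℂ}

theorem HasScalarTrace.det_eq (hρ : HasScalarTrace ρ) {U V : Cl p q}
    (h : ∀ k : ℕ, scalarPart p q (U ^ k) = scalarPart p q (V ^ k)) : (ρ U).det = (ρ V).det :=
  det_eq_of_trace_pow_eq fun k => by rw [← map_pow, ← map_pow, hρ, hρ, h]

theorem HasScalarTrace.det_rev (hρ : HasScalarTrace ρ) (U : Cl p q) :
    (ρ (rev U)).det = (ρ U).det :=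
  hρ.det_eq fun k => by rw [← rev_pow, scalarPart_rev]

theorem HasScalarTrace.det_gradeInv (hρ : HasScalarTrace ρ) (U : Cl p q) :
    (ρ (gradeInv U)).det = (ρ U).det :=
  hρ.det_eq fun k => by rw [← gradeInv_pow, scalarPart_gradeInv]

/-- Changing the sign of an element that has its square in a central subalgebra `Z` and that is
orthogonal to `Z` does not change determinants. -/
theorem HasScalarTrace.det_sub_eq_det_add (hρ : HasScalarTrace ρ) (Z : Subalgebra ℂ (Cl p q))
    {V : Cl p q} (hZ : ∀ a ∈ Z, Commute a V) (hV : V * V ∈ Z)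
    (h0 : ∀ a ∈ Z, scalarPart p q (a * V) = 0) {z : Cl p q} (hz : z ∈ Z) :
    (ρ (z - V)).det = (ρ (z + V)).det := by
  -- The powers of `z + V` and `z - V` are `a + b * V` and `a - b * V` with the same `a`, `b` in
  -- `Z`, so they share their rank-0 part `scalarPart a`.
  have h (k : ℕ) : ∃ a ∈ Z, ∃ b ∈ Z, (z + V) ^ k = a + b * V ∧ (z - V) ^ k = a - b * V := by
    induction k with
    | zero => exact ⟨1, Z.one_mem, 0, Z.zero_mem, by simp, by simp⟩
    | succ k ih =>
      obtain ⟨a, ha, b, hb, h1, h2⟩ := ih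
      have hbV : b * V * z = b * z * V := by rw [mul_assoc, ← (hZ z hz).eq, mul_assoc]
      refine ⟨a * z + b * (V * V), Z.add_mem (Z.mul_mem ha hz) (Z.mul_mem hb hV), b * z + a,
        Z.add_mem (Z.mul_mem hb hz) ha, ?_, ?_⟩
      · rw [pow_succ, h1, add_mul, mul_add, mul_add, hbV, add_mul]
        noncomm_ring
      · rw [pow_succ, h2, sub_mul, mul_sub, mul_sub, hbV, add_mul]
        noncomm_ring
  refine hρ.det_eq fun k => ?_
  obtain ⟨a, -, b, hb, h1, h2⟩ := h k
  rw [h1, h2, map_sub, map_add, h0 b hb, sub_zero, add_zero]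

theorem HasScalarTrace.det_algebraMap_sub (hρ : HasScalarTrace ρ) {V : Cl p q}
    (hV : V * V ∈ (⊥ : Subalgebra ℂ (Cl p q))) (h0 : scalarPart p q V = 0) (s : ℂ) :
    (ρ (algebraMap ℂ _ s - V)).det = (ρ (algebraMap ℂ _ s + V)).det := by
  refine hρ.det_sub_eq_det_add ⊥ ?_ hV ?_ (Subalgebra.algebraMap_mem _ s)
  · intro a ha
    obtain ⟨c, rfl⟩ := Algebra.mem_bot.1 ha
    exact Algebra.commutes c V
  · intro a ha
    obtain ⟨c, rfl⟩ := Algebra.mem_bot.1 ha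
    rw [← Algebra.smul_def, map_smul, h0, smul_zero]

theorem add_mul_sub_mem_bot {V : Cl p q} (hV : V * V ∈ (⊥ : Subalgebra ℂ (Cl p q))) (s : ℂ) :
    (algebraMap ℂ _ s + V) * (algebraMap ℂ _ s - V) ∈ (⊥ : Subalgebra ℂ (Cl p q)) := by
  have h : (algebraMap ℂ _ s + V) * (algebraMap ℂ _ s - V) =
      algebraMap ℂ _ s * algebraMap ℂ _ s - V * V := by
    rw [add_mul, mul_sub, mul_sub, Algebra.commutes s V]
    abel
  rw [h]
  exact sub_mem (mul_mem (Subalgebra.algebraMap_mem _ s) (Subalgebra.algebraMap_mem _ s)) hV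

theorem line_mem_polyFun (U V : Cl p q) : (fun t : ℂ => U + t • V) ∈ polyFun (Cl p q) :=
  Submodule.add_mem _ (const_mem_polyFun U) (smul_mem_polyFun V)

theorem rev_mem_polyFun {f : ℂ → Cl p q} (hf : f ∈ polyFun (Cl p q)) :
    (fun t => rev (f t)) ∈ polyFun (Cl p q) := map_mem_polyFun (revₗ p q) hf

theorem gradeInv_mem_polyFun {f : ℂ → Cl p q} (hf : f ∈ polyFun (Cl p q)) :
    (fun t => gradeInv (f t)) ∈ polyFun (Cl p q) := map_mem_polyFun (gradeInvₗ p q) hf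

/-- A scalar-valued polynomial function `F` with `F 1 = 1` is the determinant of a
representation of degree `N` if the determinant of `F U` is the `N`-th power of that of `U`. -/
theorem algebraMap_det_eq [Nonempty ι] (F : Cl p q → Cl p q)
    (hF : ∀ U V, (fun t : ℂ => F (U + t • V)) ∈ polyFun (Cl p q)) (h1 : F 1 = 1)
    (hs : ∀ U, F U ∈ (⊥ : Subalgebra ℂ (Cl p q)))
    (hd : ∀ U, (ρ (F U)).det = (ρ U).det ^ Fintype.card ι) (U : Cl p q) :
    algebraMap ℂ (Cl p q) (ρ U).det = F U := by
  have hs' (U : Cl p q) : algebraMap ℂ (Cl p q) (scalarPart p q (F U)) = F U := by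
    obtain ⟨c, hc⟩ := Algebra.mem_bot.1 (hs U)
    rw [← hc, scalarPart_algebraMap]
  rw [← hs' U]
  congr 1
  refine det_eq_of_pow_eq ρ (f := fun U => scalarPart p q (F U))
    (fun U V => map_mem_polyFun (scalarPart p q) (hF U V)) ?_ (fun U => ?_) U
  · rw [h1, ← map_one (algebraMap ℂ (Cl p q)), scalarPart_algebraMap]
  · rw [← hd, ← hs' U, AlgHom.commutes, scalarPart_algebraMap, Matrix.algebraMap_eq_diagonal]
    simp

end Determinant

/-! ### The formulas in dimensions 0 to 5 -/

section Formulas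

variable {p q : ℕ}

theorem ι_mul_self_mem_bot (v : Fin (p + q) → ℂ) :
    CliffordAlgebra.ι (form p q) v * CliffordAlgebra.ι (form p q) v ∈
      (⊥ : Subalgebra ℂ (Cl p q)) := by
  rw [CliffordAlgebra.ι_sq_scalar]
  exact Subalgebra.algebraMap_mem _ _

theorem pseudoscalar_mul_self_mem_bot :
    pseudoscalar p q * pseudoscalar p q ∈ (⊥ : Subalgebra ℂ (Cl p q)) := by
  obtain ⟨c, -, hc⟩ := blade_mul_self (Finset.univ : Finset (Fin (p + q)))
  rw [pseudoscalar, hc]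
  exact Subalgebra.algebraMap_mem _ _

theorem smul_mul_smul_mem {Z : Subalgebra ℂ (Cl p q)} {U V : Cl p q} (h : U * V ∈ Z) (s t : ℂ) :
    s • U * t • V ∈ Z := by
  rw [smul_mul_smul_comm]
  exact Z.smul_mem h _

/-- The cross terms cancel. -/
theorem add_mul_self_mem_of_anticommute {Z : Subalgebra ℂ (Cl p q)} {U V : Cl p q}
    (hU : U * U ∈ Z) (hV : V * V ∈ Z) (h : V * U = -(U * V)) : (U + V) * (U + V) ∈ Z := by
  have h' : (U + V) * (U + V) = U * U + V * V := by
    rw [add_mul, mul_add, mul_add, h]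
    abel
  rw [h']
  exact add_mem hU hV

theorem pseudoscalar_mul_ι_of_even (he : Even (p + q)) (v : Fin (p + q) → ℂ) :
    pseudoscalar p q * CliffordAlgebra.ι (form p q) v =
      -(CliffordAlgebra.ι (form p q) v * pseudoscalar p q) := by
  rw [pseudoscalar_mul_ι, he.add_one.neg_one_pow, neg_one_smul]

theorem ι_mul_pseudoscalar_sq_mem_bot (he : Even (p + q)) (v : Fin (p + q) → ℂ) :
    (CliffordAlgebra.ι (form p q) v * pseudoscalar p q) *
      (CliffordAlgebra.ι (form p q) v * pseudoscalar p q) ∈ (⊥ : Subalgebra ℂ (Cl p q)) := by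
  rw [mul_assoc, ← mul_assoc (pseudoscalar p q), pseudoscalar_mul_ι_of_even he, neg_mul, mul_neg,
    mul_assoc, ← mul_assoc]
  exact neg_mem (mul_mem (ι_mul_self_mem_bot v) pseudoscalar_mul_self_mem_bot)

/-- The subalgebra spanned by `1` and the pseudoscalar. -/
def pseudoscalarSubalgebra (p q : ℕ) : Subalgebra ℂ (Cl p q) where
  carrier := {U | ∃ a b : ℂ, U = algebraMap ℂ _ a + b • pseudoscalar p q}
  algebraMap_mem' a := ⟨a, 0, by simp⟩
  add_mem' := by
    rintro _ _ ⟨a, b, rfl⟩ ⟨a', b', rfl⟩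
    exact ⟨a + a', b + b', by rw [map_add, add_smul]; abel⟩
  mul_mem' := by
    rintro _ _ ⟨a, b, rfl⟩ ⟨a', b', rfl⟩
    obtain ⟨c, hc⟩ := Algebra.mem_bot.1 (pseudoscalar_mul_self_mem_bot (p := p) (q := q))
    refine ⟨a * a' + b * b' * c, a * b' + b * a', ?_⟩
    rw [add_mul, mul_add, mul_add, smul_mul_smul_comm, ← hc]
    simp only [Algebra.algebraMap_eq_smul_one, smul_mul_assoc, mul_smul_comm, one_mul, mul_one,
      smul_smul]
    module

theorem pseudoscalar_mem : pseudoscalar p q ∈ pseudoscalarSubalgebra p q := ⟨0, 1, by simp⟩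

variable {ι : Type*} [Fintype ι] [DecidableEq ι] {ρ : Cl p q →ₐ[ℂ] Matrix ι ι ℂ}

theorem algebraMap_det_zero [Nonempty ι] (hn : p + q = 0) (hι : Fintype.card ι = 1)
    (U : Cl p q) : algebraMap ℂ (Cl p q) (ρ U).det = U := by
  refine algebraMap_det_eq (fun U => U) line_mem_polyFun rfl (fun U => ?_)
    (fun U => by rw [hι, pow_one]) U
  obtain ⟨s, hs⟩ := exists_gradeProj_zero U
  rw [eq_sum_gradeProj hn U, Finset.sum_range_one, hs]
  exact Subalgebra.algebraMap_mem _ s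

theorem algebraMap_det_one [Nonempty ι] (hρ : HasScalarTrace ρ) (hn : p + q = 1)
    (hι : Fintype.card ι = 2)
    (U : Cl p q) : algebraMap ℂ (Cl p q) (ρ U).det = U * gradeInv U := by
  refine algebraMap_det_eq (fun U => U * gradeInv U)
    (fun U V => mul_mem_polyFun (line_mem_polyFun U V)
      (gradeInv_mem_polyFun (line_mem_polyFun U V)))
    (by simp only [gradeInv_one, mul_one]) (fun U => ?_)
    (fun U => by rw [hι, map_mul, Matrix.det_mul, hρ.det_gradeInv, sq]) U
  obtain ⟨s, hs⟩ := exists_gradeProj_zero U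
  obtain ⟨v, hv⟩ := exists_gradeProj_one U
  have h1 : U = algebraMap ℂ _ s + CliffordAlgebra.ι (form p q) v := by
    conv_lhs => rw [eq_sum_gradeProj hn U]
    simp [Finset.sum_range_succ, hs, hv]
  have h2 : gradeInv U = algebraMap ℂ _ s - CliffordAlgebra.ι (form p q) v := by
    rw [eq_sum_gradeProj hn (gradeInv U)]
    simp [Finset.sum_range_succ, gradeProj_gradeInv, hs, hv, sub_eq_add_neg]
  change U * gradeInv U ∈ _
  rw [h2]
  nth_rw 1 [h1]
  exact add_mul_sub_mem_bot (ι_mul_self_mem_bot v) s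

theorem algebraMap_det_two [Nonempty ι] (hρ : HasScalarTrace ρ) (hn : p + q = 2)
    (hι : Fintype.card ι = 2)
    (U : Cl p q) : algebraMap ℂ (Cl p q) (ρ U).det = U * gradeInv (rev U) := by
  refine algebraMap_det_eq (fun U => U * gradeInv (rev U))
    (fun U V => mul_mem_polyFun (line_mem_polyFun U V)
      (gradeInv_mem_polyFun (rev_mem_polyFun (line_mem_polyFun U V))))
    (by simp only [rev_one, gradeInv_one, mul_one]) (fun U => ?_)
    (fun U => by rw [hι, map_mul, Matrix.det_mul, hρ.det_gradeInv, hρ.det_rev, sq]) U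
  have hX := gradeInv_rev_mul_self U
  obtain ⟨s, hs⟩ := exists_gradeProj_zero (U * gradeInv (rev U))
  rw [eq_sum_gradeProj hn (U * gradeInv (rev U)), Finset.sum_range_succ, Finset.sum_range_succ,
    Finset.sum_range_one, gradeProj_eq_zero_of_gradeInv_rev hX (k := 1) (by decide),
    gradeProj_eq_zero_of_gradeInv_rev hX (k := 2) (by decide), hs, add_zero, add_zero]
  exact Subalgebra.algebraMap_mem _ s

/-- `X = U * rev U` has only ranks 0 and 1, so `X * gradeInv X` is a scalar minus the square of a
vector. -/
theorem algebraMap_det_three [Nonempty ι] (hρ : HasScalarTrace ρ) (hn : p + q = 3)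
    (hι : Fintype.card ι = 4)
    (U : Cl p q) :
    algebraMap ℂ (Cl p q) (ρ U).det = U * rev U * gradeInv U * gradeInv (rev U) := by
  refine algebraMap_det_eq (fun U => U * rev U * gradeInv U * gradeInv (rev U))
    (fun U V => mul_mem_polyFun (mul_mem_polyFun (mul_mem_polyFun (line_mem_polyFun U V)
      (rev_mem_polyFun (line_mem_polyFun U V))) (gradeInv_mem_polyFun (line_mem_polyFun U V)))
      (gradeInv_mem_polyFun (rev_mem_polyFun (line_mem_polyFun U V))))
    (by simp only [rev_one, gradeInv_one, mul_one]) (fun U => ?_)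
    (fun U => by
      simp only [hι, map_mul, Matrix.det_mul, hρ.det_gradeInv, hρ.det_rev]
      ring) U
  rw [mul_assoc (U * rev U), ← gradeInv_mul]
  have hX := rev_mul_rev_self U
  generalize U * rev U = X at hX
  obtain ⟨s, hs⟩ := exists_gradeProj_zero X
  obtain ⟨v, hv⟩ := exists_gradeProj_one X
  have h2 := gradeProj_eq_zero_of_rev hX (k := 2) (by decide)
  have h3 := gradeProj_eq_zero_of_rev hX (k := 3) (by decide)
  have e1 : X = algebraMap ℂ _ s + CliffordAlgebra.ι (form p q) v := by
    conv_lhs => rw [eq_sum_gradeProj hn X]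
    simp [Finset.sum_range_succ, hs, hv, h2, h3]
  have e2 : gradeInv X = algebraMap ℂ _ s - CliffordAlgebra.ι (form p q) v := by
    rw [eq_sum_gradeProj hn (gradeInv X)]
    simp [Finset.sum_range_succ, gradeProj_gradeInv, hs, hv, h2, h3, sub_eq_add_neg]
  rw [e2, e1]
  exact add_mul_sub_mem_bot (ι_mul_self_mem_bot v) s

/-- Here `X = U * gradeInv (rev U)` has only ranks 0 and 3, and the pseudoscalar takes the role of
the vector. -/
theorem algebraMap_det_three' [Nonempty ι] (hρ : HasScalarTrace ρ) (hn : p + q = 3)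
    (hι : Fintype.card ι = 4)
    (U : Cl p q) :
    algebraMap ℂ (Cl p q) (ρ U).det = U * gradeInv (rev U) * gradeInv U * rev U := by
  refine algebraMap_det_eq (fun U => U * gradeInv (rev U) * gradeInv U * rev U)
    (fun U V => mul_mem_polyFun (mul_mem_polyFun (mul_mem_polyFun (line_mem_polyFun U V)
      (gradeInv_mem_polyFun (rev_mem_polyFun (line_mem_polyFun U V))))
      (gradeInv_mem_polyFun (line_mem_polyFun U V))) (rev_mem_polyFun (line_mem_polyFun U V)))
    (by simp only [rev_one, gradeInv_one, mul_one]) (fun U => ?_)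
    (fun U => by
      simp only [hι, map_mul, Matrix.det_mul, hρ.det_gradeInv, hρ.det_rev]
      ring) U
  rw [mul_assoc (U * gradeInv (rev U)), ← gradeInv_gradeInv (rev U), ← gradeInv_mul,
    gradeInv_gradeInv]
  have hX := gradeInv_rev_mul_self U
  generalize U * gradeInv (rev U) = X at hX
  obtain ⟨s, hs⟩ := exists_gradeProj_zero X
  obtain ⟨t, ht⟩ := exists_gradeProj_last hn.symm X
  have h1 := gradeProj_eq_zero_of_gradeInv_rev hX (k := 1) (by decide)
  have h2 := gradeProj_eq_zero_of_gradeInv_rev hX (k := 2) (by decide)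
  have e1 : X = algebraMap ℂ _ s + t • pseudoscalar p q := by
    conv_lhs => rw [eq_sum_gradeProj hn X]
    simp [Finset.sum_range_succ, hs, ht, h1, h2]
  have e2 : gradeInv X = algebraMap ℂ _ s - t • pseudoscalar p q := by
    rw [eq_sum_gradeProj hn (gradeInv X)]
    simp [Finset.sum_range_succ, gradeProj_gradeInv, hs, ht, h1, h2, sub_eq_add_neg,
      Odd.neg_one_pow (show Odd 3 by decide)]
  rw [e2, e1]
  exact add_mul_sub_mem_bot (smul_mul_smul_mem pseudoscalar_mul_self_mem_bot t t) s

/-- In dimension four, `X X^⋏▽` is a scalar and `X^⋏▽` has the determinant of `X` if the square of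
the part of `X` of positive rank is a scalar. -/
theorem HasScalarTrace.nabla_gradeInv (hρ : HasScalarTrace ρ) {X : Cl p q} {s : ℂ} {V : Cl p q}
    (hV : V * V ∈ (⊥ : Subalgebra ℂ (Cl p q))) (h0 : scalarPart p q V = 0)
    (hX : X = algebraMap ℂ _ s + V) (hX' : nabla (gradeInv X) = algebraMap ℂ _ s - V) :
    X * nabla (gradeInv X) ∈ (⊥ : Subalgebra ℂ (Cl p q)) ∧
      (ρ (nabla (gradeInv X))).det = (ρ X).det := by
  rw [hX', hX]
  exact ⟨add_mul_sub_mem_bot hV s, hρ.det_algebraMap_sub hV h0 s⟩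

/-- `X = U * rev U` has ranks 0, 1, 4; `gradeInv` flips rank 1 and `nabla` flips rank 4. In even
dimension vectors anticommute with the pseudoscalar, so the part of positive rank has scalar square.
-/
theorem HasScalarTrace.nabla_gradeInv_mul_rev (hρ : HasScalarTrace ρ) (hn : p + q = 4)
    (U : Cl p q) :
    U * rev U * nabla (gradeInv U * gradeInv (rev U)) ∈ (⊥ : Subalgebra ℂ (Cl p q)) ∧
      (ρ (nabla (gradeInv U * gradeInv (rev U)))).det = (ρ (U * rev U)).det := by
  rw [← gradeInv_mul]
  have hX := rev_mul_rev_self U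
  generalize U * rev U = X at hX
  obtain ⟨s, hs⟩ := exists_gradeProj_zero X
  have h2 := gradeProj_eq_zero_of_rev hX (k := 2) (by decide)
  have h3 := gradeProj_eq_zero_of_rev hX (k := 3) (by decide)
  refine hρ.nabla_gradeInv (s := s) (V := gradeProj p q 1 X + gradeProj p q 4 X) ?_ ?_ ?_ ?_
  · obtain ⟨v, hv⟩ := exists_gradeProj_one X
    obtain ⟨t, ht⟩ := exists_gradeProj_last hn.symm X
    rw [hv, ht]
    refine add_mul_self_mem_of_anticommute (ι_mul_self_mem_bot v)
      (smul_mul_smul_mem pseudoscalar_mul_self_mem_bot t t) ?_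
    rw [smul_mul_assoc, pseudoscalar_mul_ι_of_even (by rw [hn]; decide), mul_smul_comm, smul_neg]
  · rw [map_add, scalarPart_gradeProj one_ne_zero, scalarPart_gradeProj four_ne_zero, add_zero]
  · conv_lhs => rw [eq_sum_gradeProj hn X]
    simp [Finset.sum_range_succ, hs, h2, h3, add_assoc]
  · rw [nabla_apply hn]
    simp only [Finset.sum_range_succ, Finset.sum_range_zero, gradeProj_gradeInv, hs, h2, h3]
    norm_num
    abel

/-- Now the ranks are 0, 3, 4. Rank 3 is a vector times the pseudoscalar, which again anticommutes
with the pseudoscalar. -/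
theorem HasScalarTrace.nabla_gradeInv_mul_gradeInv_rev (hρ : HasScalarTrace ρ) (hn : p + q = 4)
    (U : Cl p q) :
    U * gradeInv (rev U) * nabla (gradeInv U * rev U) ∈ (⊥ : Subalgebra ℂ (Cl p q)) ∧
      (ρ (nabla (gradeInv U * rev U))).det = (ρ (U * gradeInv (rev U))).det := by
  have h : gradeInv U * rev U = gradeInv (U * gradeInv (rev U)) := by
    rw [gradeInv_mul, gradeInv_gradeInv]
  rw [h]
  have hX := gradeInv_rev_mul_self U
  generalize U * gradeInv (rev U) = X at hX
  obtain ⟨s, hs⟩ := exists_gradeProj_zero X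
  have h1 := gradeProj_eq_zero_of_gradeInv_rev hX (k := 1) (by decide)
  have h2 := gradeProj_eq_zero_of_gradeInv_rev hX (k := 2) (by decide)
  refine hρ.nabla_gradeInv (s := s) (V := gradeProj p q 3 X + gradeProj p q 4 X) ?_ ?_ ?_ ?_
  · have he : Even (p + q) := by rw [hn]; decide
    obtain ⟨v, hv⟩ := exists_gradeProj_of_add_one_eq hn.symm X
    obtain ⟨t, ht⟩ := exists_gradeProj_last hn.symm X
    rw [hv, ht]
    refine add_mul_self_mem_of_anticommute (ι_mul_pseudoscalar_sq_mem_bot he v)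
      (smul_mul_smul_mem pseudoscalar_mul_self_mem_bot t t) ?_
    rw [smul_mul_assoc, ← mul_assoc, pseudoscalar_mul_ι_of_even he, mul_smul_comm, neg_mul,
      smul_neg]
  · rw [map_add, scalarPart_gradeProj three_ne_zero, scalarPart_gradeProj four_ne_zero, add_zero]
  · conv_lhs => rw [eq_sum_gradeProj hn X]
    simp [Finset.sum_range_succ, hs, h1, h2, add_assoc]
  · rw [nabla_apply hn]
    simp only [Finset.sum_range_succ, Finset.sum_range_zero, gradeProj_gradeInv, hs, h1, h2]
    norm_num
    abel

theorem algebraMap_det_four [Nonempty ι] (hρ : HasScalarTrace ρ) (hn : p + q = 4)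
    (hι : Fintype.card ι = 4)
    (U : Cl p q) : algebraMap ℂ (Cl p q) (ρ U).det =
      U * rev U * nabla (gradeInv U * gradeInv (rev U)) := by
  refine algebraMap_det_eq (fun U => U * rev U * nabla (gradeInv U * gradeInv (rev U)))
    (fun U V => mul_mem_polyFun (mul_mem_polyFun (line_mem_polyFun U V)
      (rev_mem_polyFun (line_mem_polyFun U V))) (map_mem_polyFun nabla (mul_mem_polyFun
      (gradeInv_mem_polyFun (line_mem_polyFun U V))
      (gradeInv_mem_polyFun (rev_mem_polyFun (line_mem_polyFun U V))))))
    (by simp only [rev_one, gradeInv_one, nabla_one, mul_one])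
    (fun U => (hρ.nabla_gradeInv_mul_rev hn U).1)
    (fun U => by
      rw [map_mul, Matrix.det_mul, (hρ.nabla_gradeInv_mul_rev hn U).2]
      simp only [hι, map_mul, Matrix.det_mul, hρ.det_rev]
      ring) U

theorem algebraMap_det_four' [Nonempty ι] (hρ : HasScalarTrace ρ) (hn : p + q = 4)
    (hι : Fintype.card ι = 4)
    (U : Cl p q) : algebraMap ℂ (Cl p q) (ρ U).det =
      U * gradeInv (rev U) * nabla (gradeInv U * rev U) := by
  refine algebraMap_det_eq (fun U => U * gradeInv (rev U) * nabla (gradeInv U * rev U))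
    (fun U V => mul_mem_polyFun (mul_mem_polyFun (line_mem_polyFun U V)
      (gradeInv_mem_polyFun (rev_mem_polyFun (line_mem_polyFun U V))))
      (map_mem_polyFun nabla (mul_mem_polyFun (gradeInv_mem_polyFun (line_mem_polyFun U V))
      (rev_mem_polyFun (line_mem_polyFun U V)))))
    (by simp only [rev_one, gradeInv_one, nabla_one, mul_one])
    (fun U => (hρ.nabla_gradeInv_mul_gradeInv_rev hn U).1)
    (fun U => by
      rw [map_mul, Matrix.det_mul, (hρ.nabla_gradeInv_mul_gradeInv_rev hn U).2]
      simp only [hι, map_mul, Matrix.det_mul, hρ.det_gradeInv, hρ.det_rev]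
      ring) U

/-- With `ω` central, `X = U * rev U` is `z + (x + y * ω)` with `z = s + t • ω` and vectors `x`,
`y`. The combined operation flips ranks 1 and 4, while rank 5 is flipped twice. Since `x * y + y *
x` is a scalar, `(x + y * ω)` squares into the centre spanned by `1` and `ω`, which plays the part
of the scalars in dimension 4. -/
theorem HasScalarTrace.nabla_gradeInv_mul_rev_of_five (hρ : HasScalarTrace ρ) (hn : p + q = 5)
    (U : Cl p q) :
    U * rev U * nabla (gradeInv U * gradeInv (rev U)) ∈ pseudoscalarSubalgebra p q ∧
      (ρ (nabla (gradeInv U * gradeInv (rev U)))).det = (ρ (U * rev U)).det := by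
  have ho : Odd (p + q) := by rw [hn]; decide
  rw [← gradeInv_mul]
  have hX := rev_mul_rev_self U
  generalize U * rev U = X at hX
  obtain ⟨s, hs⟩ := exists_gradeProj_zero X
  obtain ⟨v, hv⟩ := exists_gradeProj_one X
  have h2 := gradeProj_eq_zero_of_rev hX (k := 2) (by decide)
  have h3 := gradeProj_eq_zero_of_rev hX (k := 3) (by decide)
  obtain ⟨w, hw⟩ := exists_gradeProj_of_add_one_eq hn.symm X
  obtain ⟨t, ht⟩ := exists_gradeProj_last hn.symm X
  set x := CliffordAlgebra.ι (form p q) v with hx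
  set y := CliffordAlgebra.ι (form p q) w with hy
  set ω := pseudoscalar p q with hω
  have hωc (V : Cl p q) : ω * V = V * ω := (commute_pseudoscalar ho V).eq
  let Z := pseudoscalarSubalgebra p q
  have hωZ : ω ∈ Z := pseudoscalar_mem
  let z := algebraMap ℂ (Cl p q) s + t • ω
  have hz : z ∈ Z := ⟨s, t, rfl⟩
  have hV : (x + y * ω) * (x + y * ω) ∈ Z := by
    have h : (x + y * ω) * (x + y * ω) = x * x + (x * y + y * x) * ω + y * y * (ω * ω) := by
      have h1 : y * ω * x = y * x * ω := by rw [mul_assoc, hωc, mul_assoc]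
      have h2 : y * ω * (y * ω) = y * y * (ω * ω) := by
        rw [mul_assoc, ← mul_assoc ω, hωc y, mul_assoc, mul_assoc]
      rw [add_mul, mul_add, mul_add, h1, h2, add_mul, mul_assoc x y ω]
      abel
    have hxy : x * y + y * x ∈ Z := by
      rw [hx, hy, CliffordAlgebra.ι_mul_ι_add_swap]
      exact Subalgebra.algebraMap_mem _ _
    rw [h]
    exact add_mem (add_mem (bot_le (a := Z) (ι_mul_self_mem_bot v)) (mul_mem hxy hωZ))
      (mul_mem (bot_le (a := Z) (ι_mul_self_mem_bot w)) (mul_mem hωZ hωZ))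
  have hZ : ∀ a ∈ Z, Commute a (x + y * ω) := by
    rintro _ ⟨a, b, rfl⟩
    exact (Algebra.commute_algebraMap_left a _).add_left ((commute_pseudoscalar ho _).smul_left b)
  have h0 : ∀ a ∈ Z, scalarPart p q (a * (x + y * ω)) = 0 := by
    rintro _ ⟨a, b, rfl⟩
    obtain ⟨c, hc⟩ := Algebra.mem_bot.1 (pseudoscalar_mul_self_mem_bot (p := p) (q := q))
    have h : (algebraMap ℂ _ a + b • ω) * (x + y * ω) =
        a • x + a • (y * ω) + b • (x * ω) + (b * c) • y := by
      have h1 : ω * (y * ω) = c • y := by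
        rw [← mul_assoc, hωc, mul_assoc, ← hc, ← Algebra.commutes, ← Algebra.smul_def]
      rw [add_mul, mul_add, mul_add, smul_mul_assoc, smul_mul_assoc, h1, hωc x,
        ← Algebra.smul_def, ← Algebra.smul_def, smul_smul]
      abel
    have hn1 : p + q ≠ 1 := by omega
    rw [h]
    simp only [map_add, map_smul, hx, hy, hω, scalarPart_ι, scalarPart_ι_mul_pseudoscalar hn1,
      smul_zero, add_zero]
  have e1 : X = z + (x + y * ω) := by
    conv_lhs => rw [eq_sum_gradeProj hn X]
    simp only [Finset.sum_range_succ, Finset.sum_range_zero, hs, hv, h2, h3, hw, ht, z]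
    abel
  have e2 : nabla (gradeInv X) = z - (x + y * ω) := by
    rw [nabla_apply hn]
    simp only [Finset.sum_range_succ, Finset.sum_range_zero, gradeProj_gradeInv, hs, hv, h2, h3,
      hw, ht, z]
    norm_num
    abel
  rw [e2, e1]
  refine ⟨?_, hρ.det_sub_eq_det_add Z hZ hV h0 hz⟩
  have h : (z + (x + y * ω)) * (z - (x + y * ω)) = z * z - (x + y * ω) * (x + y * ω) := by
    rw [add_mul, mul_sub, mul_sub, (hZ z hz).eq]
    abel
  rw [h]
  exact sub_mem (mul_mem hz hz) hV

/-- Only ranks 0 and 5 occur, where `delta` agrees with `gradeInv`; this is how `delta` is seen to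
preserve the determinant. -/
theorem delta_of_mem_pseudoscalarSubalgebra (hn : p + q = 5) {Y : Cl p q}
    (hY : Y ∈ pseudoscalarSubalgebra p q) :
    delta Y = gradeInv Y ∧ Y * delta Y ∈ (⊥ : Subalgebra ℂ (Cl p q)) := by
  obtain ⟨a, b, rfl⟩ := hY
  have hc : (Finset.univ : Finset (Fin (p + q))).card = 5 := by simp [hn]
  have h1 : delta (algebraMap ℂ (Cl p q) a + b • pseudoscalar p q) =
      algebraMap ℂ _ a - b • pseudoscalar p q := by
    rw [map_add, map_smul, pseudoscalar, delta_blade, if_pos hc, Algebra.algebraMap_eq_smul_one,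
      map_smul, delta_one, neg_one_smul, smul_neg, sub_eq_add_neg]
  have h2 : gradeInv (algebraMap ℂ (Cl p q) a + b • pseudoscalar p q) =
      algebraMap ℂ _ a - b • pseudoscalar p q := by
    rw [← gradeInvₗ_apply, map_add, map_smul, pseudoscalar, gradeInvₗ_apply (blade p q _),
      gradeInv_blade, hc, Odd.neg_one_pow (by decide), Algebra.algebraMap_eq_smul_one,
      map_smul, gradeInvₗ_apply, gradeInv_one, neg_one_smul, smul_neg, sub_eq_add_neg]
  rw [h2, h1]
  exact ⟨rfl, add_mul_sub_mem_bot (smul_mul_smul_mem pseudoscalar_mul_self_mem_bot b b) a⟩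

theorem algebraMap_det_five [Nonempty ι] (hρ : HasScalarTrace ρ) (hn : p + q = 5)
    (hι : Fintype.card ι = 8)
    (U : Cl p q) : algebraMap ℂ (Cl p q) (ρ U).det =
      U * rev U * nabla (gradeInv U * gradeInv (rev U)) *
        delta (U * rev U * nabla (gradeInv U * gradeInv (rev U))) := by
  have hY (U V : Cl p q) : (fun t : ℂ => (U + t • V) * rev (U + t • V) *
      nabla (gradeInv (U + t • V) * gradeInv (rev (U + t • V)))) ∈ polyFun (Cl p q) :=
    mul_mem_polyFun (mul_mem_polyFun (line_mem_polyFun U V)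
      (rev_mem_polyFun (line_mem_polyFun U V))) (map_mem_polyFun nabla (mul_mem_polyFun
      (gradeInv_mem_polyFun (line_mem_polyFun U V))
      (gradeInv_mem_polyFun (rev_mem_polyFun (line_mem_polyFun U V)))))
  have hdelta (U : Cl p q) :=
    delta_of_mem_pseudoscalarSubalgebra hn (hρ.nabla_gradeInv_mul_rev_of_five hn U).1
  refine algebraMap_det_eq (fun U => U * rev U * nabla (gradeInv U * gradeInv (rev U)) *
      delta (U * rev U * nabla (gradeInv U * gradeInv (rev U))))
    (fun U V => mul_mem_polyFun (hY U V) (map_mem_polyFun delta (hY U V)))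
    (by simp only [rev_one, gradeInv_one, nabla_one, delta_one, mul_one])
    (fun U => (hdelta U).2)
    (fun U => by
      rw [(hdelta U).1, map_mul, Matrix.det_mul, hρ.det_gradeInv, map_mul, Matrix.det_mul,
        (hρ.nabla_gradeInv_mul_rev_of_five hn U).2]
      simp only [hι, map_mul, Matrix.det_mul, hρ.det_rev]
      ring) U

end Formulas

theorem exists_isMinimalRep_det_eq {p q : ℕ} :
    ∃ (N : ℕ) (ρ : Cl p q →ₐ[ℂ] Matrix (Fin N) (Fin N) ℂ), IsMinimalRep ρ ∧
      ∀ U, (ρ U).det = Det U :=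
  ⟨_, _, (exists_isMinimalRep p q).choose_spec.choose_spec, fun _ => rfl⟩

end ComplexClifford

end

/-! ### The main theorem -/

open ComplexClifford in
theorem mainTheorem1 (p q : ℕ) (hn : p + q ≤ 5) (U : Cl p q) :
    (∀ (N : ℕ) (ρ : Cl p q →ₐ[ℂ] Matrix (Fin N) (Fin N) ℂ),
      IsMinimalRep ρ → (ρ U).det = Det U) ∧
    (p + q = 0 → algebraMap ℂ (Cl p q) (Det U) = U) ∧
    (p + q = 1 → algebraMap ℂ (Cl p q) (Det U) = U * gradeInv U) ∧
    (p + q = 2 → algebraMap ℂ (Cl p q) (Det U) = U * gradeInv (rev U)) ∧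
    (p + q = 3 →
      algebraMap ℂ (Cl p q) (Det U) = U * rev U * gradeInv U * gradeInv (rev U) ∧
      algebraMap ℂ (Cl p q) (Det U) = U * gradeInv (rev U) * gradeInv U * rev U) ∧
    (p + q = 4 →
      algebraMap ℂ (Cl p q) (Det U) = U * rev U * nabla (gradeInv U * gradeInv (rev U)) ∧
      algebraMap ℂ (Cl p q) (Det U) = U * gradeInv (rev U) * nabla (gradeInv U * rev U)) ∧
    (p + q = 5 →
      algebraMap ℂ (Cl p q) (Det U) =
        U * rev U * nabla (gradeInv U * gradeInv (rev U)) *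
          delta (U * rev U * nabla (gradeInv U * gradeInv (rev U)))) := by
  obtain ⟨N, ρ, hρ, hdet⟩ := exists_isMinimalRep_det_eq (p := p) (q := q)
  have htr := hρ.hasScalarTrace
  have hN {k : ℕ} (hk : p + q = k) : Fintype.card (Fin N) = 2 ^ ((k + 1) / 2) := by
    rw [Fintype.card_fin, hρ.eq_two_pow, hk]
  have : Nonempty (Fin N) := Fintype.card_pos_iff.1 (by rw [hN rfl]; positivity)
  rw [← hdet U]
  refine ⟨fun M σ hσ => ?_, fun h => algebraMap_det_zero h (hN h) U,
    fun h => algebraMap_det_one htr h (hN h) U, fun h => algebraMap_det_two htr h (hN h) U,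
    fun h => ⟨algebraMap_det_three htr h (hN h) U, algebraMap_det_three' htr h (hN h) U⟩,
    fun h => ⟨algebraMap_det_four htr h (hN h) U, algebraMap_det_four' htr h (hN h) U⟩,
    fun h => algebraMap_det_five htr h (hN h) U⟩
  -- Two minimal representations have the same degree and the same trace function, hence the same
  -- determinant.
  have hMN : M = N := by rw [hσ.eq_two_pow, hρ.eq_two_pow]
  subst hMN
  refine det_eq_of_trace_pow_eq fun k => ?_
  rw [← map_pow, ← map_pow, htr, hσ.hasScalarTrace]
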